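/- Let $(R,\mathfrak m)$ be a Noetherian local ring of prime characteristic $p>0$ (commutative with identity), let $M$ be a finitely generated $R$-module, and let $s>0$ be a real number. For a Noetherian local ring $(A,\mathfrak n)$ of characteristic $p$ and dimension $d$, $\mathfrak n$-primary ideals $I,J$ of $A$ and a finitely generated $A$-module $N$, put $$h_s(I,J;N)=\lim_{e\to\infty}\frac{\ell_A\bigl(N/(I^{\lceil sp^e\rceil}+J^{[p^e]})N\bigr)}{p^{ed}},\qquad \mathcal H_s(d)=\sum_{i=0}^{\lfloor s\rfloor}\frac{(-1)^i}{d!}\binom di (s-i)^d,\qquad e_s(I,J;N)=\frac{h_s(I,J;N)}{\mathcal H_s(d)},$$ where $J^{[p^e]}$ is the ideal generated by the $p^e$-th powers of the elements of $J$ and $0^0=1$. Write $e_s(I)=e_s(I,I;A)$, $e_s(N)=e_s(\mathfrak n,\mathfrak n;N)$ and $e_s(A)=e_s(\mathfrak n,\mathfrak n;A)$. Let $R\ltimes M$ be the idealization of $M$, that is, $R\oplus M$ with multiplication $(r,m)(r',m')=(rr',rm'+r'm)$; it is a local ring with maximal ideal $\mathfrak m\ltimes M$, and $\mathfrak m\ltimes\mathfrak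 mM=\{(r,m): r\in\mathfrak m,\ m\in\mathfrak mM\}$ is an ideal of it. Then the limits defining $e_s(R)$, $e_s(M)$, $e_s(R\ltimes M)$ and $e_s(\mathfrak m\ltimes\mathfrak mM)$ exist, and $$e_s(R\ltimes M)\ \le\ e_s(\mathfrak m\ltimes\mathfrak mM)\ =\ e_s(R)+e_s(M).$$ In particular, if $\dim M<\dim R$, then $e_s(R\ltimes M)\le e_s(R)$. -/

import Mathlib

open Filter Topology IsLocalRing

noncomputable section

/-- The Krull dimension of a ring as a natural number (for rings of finite dimension, such as
Noetherian local rings). -/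
def krullDimNat (R : Type*) [CommRing R] : ℕ := ((ringKrullDim R).unbotD 0).toNat

/-- The bracket power `J^[q]`: the ideal generated by the `q`-th powers of the elements of `J`. -/
def bracketPower {R : Type*} [CommRing R] (J : Ideal R) (q : ℕ) : Ideal R :=
  Ideal.span ((fun x : R => x ^ q) '' (J : Set R))

/-- The term of index `e` in the sequence whose limit is `h_s(I, J; M)`:
`ℓ_R (M / (I^⌈s p^e⌉ + J^[p^e]) M) / p^(e d)` with `d = dim R`.
The length is finite when `I` and `J` are primary to the maximal ideal of a Noetherian local ring
and `M` is finitely generated. -/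
def hSeq {R : Type*} [CommRing R] (p : ℕ) (s : ℝ) (I J : Ideal R)
    (M : Type*) [AddCommGroup M] [Module R M] (e : ℕ) : ℝ :=
  ((Module.length R
      (M ⧸ ((I ^ ⌈s * (p : ℝ) ^ e⌉₊ + bracketPower J (p ^ e)) • (⊤ : Submodule R M)))).toNat : ℝ)
    / (p : ℝ) ^ (e * krullDimNat R)

/-- The limit that defines `h_s(I, J; M)` exists. -/
def HasHLimit {R : Type*} [CommRing R] (p : ℕ) (s : ℝ) (I J : Ideal R)
    (M : Type*) [AddCommGroup M] [Module R M] : Prop :=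
  ∃ L : ℝ, Tendsto (hSeq p s I J M) atTop (𝓝 L)

/-- The `h`-function `h_s(I, J; M)`. -/
def hFunction {R : Type*} [CommRing R] (p : ℕ) (s : ℝ) (I J : Ideal R)
    (M : Type*) [AddCommGroup M] [Module R M] : ℝ :=
  limUnder atTop (hSeq p s I J M)

/-- The normalizing factor `𝓗_s(d) = ∑_{i=0}^{⌊s⌋} ((-1)^i / d!) (d choose i) (s - i)^d`. -/
def hNormal (s : ℝ) (d : ℕ) : ℝ :=
  ∑ i ∈ Finset.range (⌊s⌋₊ + 1),
    (-1 : ℝ) ^ i / (d.factorial : ℝ) * (d.choose i : ℝ) * (s - (i : ℝ)) ^ d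

/-- The `s`-multiplicity `e_s(I, J; M) = h_s(I, J; M) / 𝓗_s(dim R)`. -/
def sMult {R : Type*} [CommRing R] (p : ℕ) (s : ℝ) (I J : Ideal R)
    (M : Type*) [AddCommGroup M] [Module R M] : ℝ :=
  hFunction p s I J M / hNormal s (krullDimNat R)

/-- `e_s(I) = e_s(I, I; R)`. -/
def sMultIdeal {R : Type*} [CommRing R] (p : ℕ) (s : ℝ) (I : Ideal R) : ℝ :=
  sMult p s I I R

/-- `e_s(M) = e_s(𝔪, 𝔪; M)` for a module `M` over a local ring `(R, 𝔪)`. -/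
def sMultModule (R : Type*) [CommRing R] [IsLocalRing R] (p : ℕ) (s : ℝ)
    (M : Type*) [AddCommGroup M] [Module R M] : ℝ :=
  sMult p s (maximalIdeal R) (maximalIdeal R) M

/-- `e_s(R) = e_s(𝔪, 𝔪; R)` for a local ring `(R, 𝔪)`. -/
def sMultRing (R : Type*) [CommRing R] [IsLocalRing R] (p : ℕ) (s : ℝ) : ℝ :=
  sMultModule R p s R

/-- The idealization `R ⋉ M` of a module over a local ring is local. -/
instance idealization_isLocalRing (R M : Type*) [CommRing R] [IsLocalRing R] [AddCommGroup M]
    [Module R M] [Module Rᵐᵒᵖ M] [IsCentralScalar R M] : IsLocalRing (TrivSqZeroExt R M) :=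
  IsLocalRing.of_nonunits_add (by
    intro a b ha hb
    simp only [mem_nonunits_iff, TrivSqZeroExt.isUnit_iff_isUnit_fst, TrivSqZeroExt.fst_add]
      at ha hb ⊢
    exact IsLocalRing.nonunits_add ha hb)

/-- The ideal `I ⋉ I M = {(r, m) | r ∈ I, m ∈ I M}` of `R ⋉ M`. -/
def idealizationIdeal {R : Type*} (M : Type*) [CommRing R] [AddCommGroup M]
    [Module R M] [Module Rᵐᵒᵖ M] [IsCentralScalar R M] (I : Ideal R) :
    Ideal (TrivSqZeroExt R M) where
  carrier := {x | x.fst ∈ I ∧ x.snd ∈ I • (⊤ : Submodule R M)}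
  zero_mem' := by simp
  add_mem' := fun {a b} ha hb => by
    refine ⟨?_, ?_⟩
    · rw [TrivSqZeroExt.fst_add]; exact I.add_mem ha.1 hb.1
    · rw [TrivSqZeroExt.snd_add]; exact Submodule.add_mem _ ha.2 hb.2
  smul_mem' := fun c x hx => by
    refine ⟨?_, ?_⟩
    · rw [smul_eq_mul, TrivSqZeroExt.fst_mul]; exact I.mul_mem_left _ hx.1
    · rw [smul_eq_mul, TrivSqZeroExt.snd_mul, op_smul_eq_smul]
      exact Submodule.add_mem _ (Submodule.smul_mem _ _ hx.2)
        (Submodule.smul_mem_smul hx.1 Submodule.mem_top)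

end

/-! Write `S = R ⋉ M` with maximal ideal `𝔫`, `q = p^e`, `d = dim R`. The middle ideal `𝔪 ⋉ 𝔪M` is
the extension `𝔪S`. As an `R`-module `S` is `R ⊕ M`, and `S` has the residue field of `R`, so for
the extended ideals the lengths over `S` are sums of those for `R` and `M`. This gives the equality.
For `𝔫` itself, `(r, m)^q = (r^q, q r^(q-1) m)` shows that `𝔫` and `𝔪S` have the same bracket powers
once `e ≥ 1`, while `𝔫² ⊆ 𝔪S·𝔫` gives `(𝔪S)^a ⊆ 𝔫^a ⊆ (𝔪S)^(a-1)`. Moving the exponent by one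
changes lengths by `O(q^(d-1))`, so the two limits agree and the inequality is in fact an equality
(`smallDiff_lenMod_maximalIdeal`). If `dim M < dim R`, the contribution of `M` vanishes in the
limit.

The bulk of the work is the existence of the limits for a finite module `N`. Suppose first that
Frobenius is finite and the residue field perfect. With `I_e = 𝔪^⌈sq⌉ + 𝔪^[q]`, the ideals `I_(e+k)`
and `I_e^[p^k]` give lengths differing by `O(q^(d-1))`, and the length for `I_e^[p^k]` on `N` is the
length for `I_e` on the Frobenius pushforward of `N`. For `N = R/Q` with `Q` prime, the pushforward
agrees generically with `(R/Q)^n`, so the normalized lengths satisfy `a_(e+1) = (n/p^d) a_e +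
O(p^(-e))`. A bounded sequence of this kind converges whatever `n` is. For general `N`, a high
pushforward is killed by the radical of the annihilator and agrees generically with a sum of modules
`R/Q`.

An arbitrary `R` is reduced to this case by `exists_mvPowerSeries_module`. Compatible lifts of the
residue field `k` to the quotients `R/𝔪^(t+1)` make these quotients of `k[X]`. The relations of `N`
modulo powers of `𝔪` are carried along the flat map `k[X] → K⟦X⟧`, `K` the algebraic closure of `k`,
and intersected, giving a finite `K⟦X⟧`-module with the same lengths and dimension at most `d`. -/

noncomputable section

/-! ### Lengths of the quotients `N / I N` -/

section Length

variable {R : Type*} [CommRing R]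

/-- The length of `N / I N`. -/
def lenMod (I : Ideal R) (N : Type*) [AddCommGroup N] [Module R N] : ℕ∞ :=
  Module.length R (N ⧸ (I • (⊤ : Submodule R N)))

variable {N N' : Type*} [AddCommGroup N] [Module R N] [AddCommGroup N'] [Module R N']

theorem lenMod_anti {I J : Ideal R} (h : I ≤ J) : lenMod J N ≤ lenMod I N :=
  Module.length_le_of_surjective
    (Submodule.factor (Submodule.smul_mono_left h)) (Submodule.factor_surjective _)

theorem lenMod_le_length (I : Ideal R) : lenMod I N ≤ Module.length R N :=
  Module.length_le_of_surjective (Submodule.mkQ _) (Submodule.mkQ_surjective _)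

theorem lenMod_le_of_surjective (I : Ideal R) (f : N →ₗ[R] N') (hf : Function.Surjective f) :
    lenMod I N' ≤ lenMod I N := by
  refine Module.length_le_of_surjective
    (Submodule.mapQ (I • ⊤) (I • ⊤) f (by
      rw [← Submodule.map_le_iff_le_comap, Submodule.map_smul'']
      exact smul_mono_right _ le_top)) ?_
  intro y
  obtain ⟨y, rfl⟩ := Submodule.mkQ_surjective _ y
  obtain ⟨x, rfl⟩ := hf y
  exact ⟨Submodule.mkQ _ x, rfl⟩

theorem lenMod_congr (I : Ideal R) (e : N ≃ₗ[R] N') : lenMod I N = lenMod I N' :=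
  le_antisymm (lenMod_le_of_surjective I e.symm.toLinearMap e.symm.surjective)
    (lenMod_le_of_surjective I e.toLinearMap e.surjective)

theorem length_eq_add_quotient (A : Submodule R N) :
    Module.length R N = Module.length R A + Module.length R (N ⧸ A) :=
  Module.length_eq_add_of_exact A.subtype A.mkQ A.subtype_injective A.mkQ_surjective
    (LinearMap.exact_subtype_mkQ A)

/-- Right exactness of `N ↦ N / I N`, in the form of an inequality of lengths. -/
theorem lenMod_le_add_of_map {I I' : Ideal R} (f : N' →ₗ[R] N)
    (h : I' • (⊤ : Submodule R N') ≤ (I • (⊤ : Submodule R N)).comap f) :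
    lenMod I N ≤ lenMod I' N' + lenMod I (N ⧸ LinearMap.range f) := by
  set g := Submodule.mapQ (I' • ⊤) (I • ⊤) f h with hg
  unfold lenMod
  rw [length_eq_add_quotient (LinearMap.range g)]
  refine add_le_add (Module.length_le_of_surjective g.rangeRestrict g.surjective_rangeRestrict) ?_
  set π : N →ₗ[R] (N ⧸ I • (⊤ : Submodule R N)) ⧸ LinearMap.range g :=
    (LinearMap.range g).mkQ ∘ₗ (I • (⊤ : Submodule R N)).mkQ with hπ
  have hπs : Function.Surjective π :=
    (Submodule.mkQ_surjective _).comp (Submodule.mkQ_surjective _)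
  have h1 : LinearMap.range f ≤ LinearMap.ker π := by
    rintro _ ⟨x, rfl⟩
    simp only [hπ, LinearMap.mem_ker, LinearMap.comp_apply, Submodule.mkQ_apply,
      Submodule.Quotient.mk_eq_zero]
    exact ⟨Submodule.Quotient.mk x, rfl⟩
  have h2 : I • (⊤ : Submodule R (N ⧸ LinearMap.range f)) ≤
      LinearMap.ker ((LinearMap.range f).liftQ π h1) := by
    rw [Submodule.smul_le]
    rintro r hr n -
    obtain ⟨n, rfl⟩ := Submodule.mkQ_surjective _ n
    rw [LinearMap.mem_ker, map_smul, Submodule.mkQ_apply, Submodule.liftQ_apply, ← map_smul]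
    simp only [hπ, LinearMap.comp_apply, Submodule.mkQ_apply]
    rw [(Submodule.Quotient.mk_eq_zero (I • (⊤ : Submodule R N))).2
      (Submodule.smul_mem_smul hr Submodule.mem_top)]
    exact Submodule.Quotient.mk_zero _
  refine Module.length_le_of_surjective (Submodule.liftQ _ _ h2) ?_
  intro y
  obtain ⟨x, rfl⟩ := hπs y
  exact ⟨Submodule.mkQ _ (Submodule.mkQ _ x), rfl⟩

theorem lenMod_le_add (I : Ideal R) (f : N' →ₗ[R] N) :
    lenMod I N ≤ lenMod I N' + lenMod I (N ⧸ LinearMap.range f) :=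
  lenMod_le_add_of_map f (by
    rw [← Submodule.map_le_iff_le_comap, Submodule.map_smul'']
    exact smul_mono_right _ le_top)

theorem lenMod_eq_zero [Subsingleton N] (I : Ideal R) : lenMod I N = 0 := by
  have : Subsingleton (N ⧸ (I • (⊤ : Submodule R N))) :=
    (Submodule.mkQ_surjective (I • (⊤ : Submodule R N))).subsingleton
  exact Module.length_eq_zero

theorem lenMod_pi {ι : Type*} [Finite ι] (I : Ideal R) (F : ι → Type*) [∀ i, AddCommGroup (F i)]
    [∀ i, Module R (F i)] [Fintype ι] : lenMod I (∀ i, F i) = ∑ i, lenMod I (F i) := by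
  classical
  unfold lenMod
  rw [← Module.length_pi_of_fintype]
  have key : I • (⊤ : Submodule R (∀ i, F i)) =
      Submodule.pi Set.univ (fun i => I • (⊤ : Submodule R (F i))) := by
    apply le_antisymm
    · rw [Submodule.smul_le]
      intro r hr n _ i _
      exact Submodule.smul_mem_smul hr Submodule.mem_top
    · intro x hx
      have : x = ∑ i, LinearMap.single R F i (x i) := by
        ext j
        simp [LinearMap.single_apply, Finset.sum_apply]
      rw [this]
      refine Submodule.sum_mem _ fun i _ => ?_
      have h3 : LinearMap.single R F i (x i) ∈
          (I • (⊤ : Submodule R (F i))).map (LinearMap.single R F i) :=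
        ⟨_, hx i (Set.mem_univ _), rfl⟩
      rw [Submodule.map_smul''] at h3
      exact smul_mono_right I (le_top (a := Submodule.map (LinearMap.single R F i) ⊤)) h3
  rw [key]
  exact (Submodule.quotientPi (fun i => I • (⊤ : Submodule R (F i)))).length_eq

end Length

/-! ### Length under restriction of scalars -/

section ResidueChange

/-- Lengths do not change under restriction of scalars along a local homomorphism that is
surjective modulo the maximal ideals. -/
theorem length_eq_of_residue_surjective {A B : Type*} [CommRing A] [CommRing B] [IsLocalRing B]
    [Algebra A B]
    (hs : ∀ b : B, ∃ a : A, b - algebraMap A B a ∈ maximalIdeal B)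
    (X : Type*) [AddCommGroup X] [Module A X] [Module B X] [IsScalarTower A B X] :
    Module.length A X = Module.length B X := by
  -- A simple `B`-module is killed by the maximal ideal, and `A` reaches every residue class, so it
  -- stays simple over `A`.
  have simple : ∀ (Y : Type _) [AddCommGroup Y] [Module A Y] [Module B Y] [IsScalarTower A B Y]
      [IsSimpleModule B Y], Module.length A Y = 1 := by
    intro Y _ _ _ _ _
    have hann : ∀ b ∈ maximalIdeal B, ∀ y : Y, b • y = 0 := by
      intro b hb y
      have := IsSimpleModule.annihilator_isMaximal (R := B) (M := Y)
      rw [← IsLocalRing.eq_maximalIdeal this] at hb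
      exact Module.mem_annihilator.1 hb y
    have hsm : IsSimpleModule A Y := by
      have : Nontrivial Y := IsSimpleModule.nontrivial B Y
      rw [isSimpleModule_iff_toSpanSingleton_surjective]
      refine ⟨inferInstance, fun y hy z => ?_⟩
      obtain ⟨b, hb⟩ := IsSimpleModule.toSpanSingleton_surjective B hy z
      obtain ⟨a, ha⟩ := hs b
      refine ⟨a, ?_⟩
      have h1 := hann _ ha y
      rw [sub_smul, sub_eq_zero, algebraMap_smul] at h1
      simpa [← h1] using hb
    exact Module.length_eq_one A Y
  have fin : IsFiniteLength B X → ∀ (_ : Module A X) (_ : IsScalarTower A B X),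
      Module.length A X = Module.length B X := by
    clear * - simple
    intro hX
    induction hX with
    | of_subsingleton =>
      intro _ _
      rw [Module.length_eq_zero, Module.length_eq_zero]
    | @of_simple_quotient M _ _ S _ _ ih =>
      intro _ _
      rw [length_eq_add_quotient S, length_eq_add_quotient (S.restrictScalars A)]
      have h1 : Module.length A (S.restrictScalars A) = Module.length B S :=
        ih inferInstance inferInstance
      have h2 : Module.length A (M ⧸ S.restrictScalars A) = 1 := simple (M ⧸ S)
      rw [h1, h2, Module.length_eq_one B (M ⧸ S)]
  by_cases hX : IsFiniteLength B X
  · exact fin hX inferInstance inferInstance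
  · have h1 : Module.length B X = ⊤ := by
      by_contra h
      exact hX (Module.length_ne_top_iff.1 h)
    -- For infinite length, chains of `B`-submodules are also chains of `A`-submodules.
    rw [h1, eq_top_iff, ← h1, Module.length_eq_height, Module.length_eq_height]
    have := Order.height_le_height_apply_of_strictMono
      (Submodule.restrictScalars A : Submodule B X → Submodule A X)
      (fun a b h => (Submodule.restrictScalarsEmbedding A B X).strictMono h) ⊤
    simpa using this

end ResidueChange

/-! ### Growth of Hilbert-Samuel functions -/

section Growth

open Pointwise

variable {R : Type*} [CommRing R] [IsLocalRing R] [IsNoetherianRing R]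

/-- Prime avoidance finds `c` outside the minimal primes over the annihilator, unless `𝔪` is one of
them; then the dimension is at most 0 and `c = 0` will do. This drives the induction on dimension.
-/
theorem exists_notMem_of_supportDim (N : Type*) [AddCommGroup N] [Module R N] [Module.Finite R N]
    (d : ℕ) (h : Module.supportDim R N ≤ (d + 1 : ℕ)) :
    ∃ c ∈ maximalIdeal R, Module.supportDim R (QuotSMulTop c N) ≤ d := by
  by_cases hm : maximalIdeal R ∈ (Module.annihilator R N).minimalPrimes
  · refine ⟨0, Ideal.zero_mem _, ?_⟩
    refine (Module.supportDim_le_of_surjective _ (Submodule.mkQ_surjective _)).trans ?_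
    have : Module.supportDim R N ≤ 0 := by
      rw [Module.supportDim_eq_ringKrullDim_quotient_annihilator]
      have := IsLocalRing.quotient_artinian_of_mem_minimalPrimes_of_isLocalRing _ hm
      simpa [Ring.krullDimLE_iff] using
        (inferInstance : Ring.KrullDimLE 0 (R ⧸ Module.annihilator R N))
    exact this.trans (by exact_mod_cast Nat.zero_le d)
  · have hfin := Ideal.finite_minimalPrimes_of_isNoetherianRing R (Module.annihilator R N)
    have : ¬ ((maximalIdeal R : Set R) ⊆
        ⋃ P ∈ (hfin.toFinset : Set (Ideal R)), ((id P : Ideal R) : Set R)) := by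
      rw [Ideal.subset_union_prime ⊥ ⊥]
      · rintro ⟨P, hP, hle⟩
        have hP' := hfin.mem_toFinset.1 hP
        have : maximalIdeal R = P :=
          le_antisymm hle (le_maximalIdeal hP'.1.1.ne_top)
        exact hm (this ▸ hP')
      · intro P hP _ _
        exact (hfin.mem_toFinset.1 hP).1.1
    obtain ⟨c, hc, hc'⟩ := Set.not_subset.1 this
    refine ⟨c, hc, ?_⟩
    have h1 := Module.supportDim_quotSMulTop_succ_le_of_notMem_minimalPrimes (M := N) (x := c)
      (fun P hP hcP => hc' (by
        simp only [Set.mem_iUnion]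
        exact ⟨P, hfin.mem_toFinset.2 hP, hcP⟩))
    have h2 := h1.trans h
    push_cast at h2
    exact (ENat.WithBot.add_le_add_one_right_iff).1 h2

omit [IsNoetherianRing R] in
-- Multiplication by `c` carries `𝔪^t N` into `𝔪^(t+1) N` and has cokernel `N / cN`. Only right
-- exactness is used, so `c` may be a zero divisor.
theorem lenMod_pow_succ_le (N : Type*) [AddCommGroup N] [Module R N]
    {c : R} (hc : c ∈ maximalIdeal R) (t : ℕ) :
    lenMod (maximalIdeal R ^ (t + 1)) N ≤
      lenMod (maximalIdeal R ^ t) N + lenMod (maximalIdeal R ^ (t + 1)) (QuotSMulTop c N) := by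
  have h1 := lenMod_le_add_of_map (I := maximalIdeal R ^ (t + 1)) (I' := maximalIdeal R ^ t)
    (N := N) (N' := N) (LinearMap.lsmul R N c) (by
      rw [Submodule.smul_le]
      intro r hr n _
      rw [Submodule.mem_comap, LinearMap.lsmul_apply, smul_smul]
      refine Submodule.smul_mem_smul ?_ Submodule.mem_top
      rw [pow_succ']
      exact Ideal.mul_mem_mul hc hr)
  have h2 : LinearMap.range (LinearMap.lsmul R N c) =
      (c • (⊤ : Submodule R N)) := by
    ext x
    simp [Submodule.mem_smul_pointwise_iff_exists]
  rw [h2] at h1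
  exact h1

theorem exists_pow_smul_top_eq_bot {N : Type*} [AddCommGroup N] [Module R N] [Module.Finite R N]
    (h : Module.supportDim R N ≤ 0) : ∃ c, maximalIdeal R ^ c • (⊤ : Submodule R N) = ⊥ := by
  rw [Module.supportDim_eq_ringKrullDim_quotient_annihilator] at h
  have h0 : Ring.KrullDimLE 0 (R ⧸ Module.annihilator R N) := by
    simpa [Ring.krullDimLE_iff] using h
  have := IsNoetherianRing.isArtinianRing_of_krullDimLE_zero (R := R ⧸ Module.annihilator R N)
  obtain ⟨c, hc⟩ := exists_maximalIdeal_pow_le_of_isArtinianRing_quotient (Module.annihilator R N)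
  refine ⟨c, ?_⟩
  rw [eq_bot_iff, Submodule.smul_le]
  intro r hr n _
  exact Module.mem_annihilator.1 (hc hr) n

theorem lenMod_pow_ne_top (N : Type*) [AddCommGroup N] [Module R N] [Module.Finite R N] (t : ℕ) :
    lenMod (maximalIdeal R ^ t) N ≠ ⊤ := by
  have hart : IsArtinianRing (R ⧸ maximalIdeal R ^ t) := by
    rcases Nat.eq_zero_or_pos t with rfl | ht
    · have : Subsingleton (R ⧸ maximalIdeal R ^ 0) := by
        rw [pow_zero, Ideal.one_eq_top]; exact Ideal.Quotient.subsingleton_iff.2 rfl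
      infer_instance
    · refine IsLocalRing.quotient_artinian_of_mem_minimalPrimes_of_isLocalRing _ ?_
      refine ⟨⟨inferInstance, Ideal.pow_le_self ht.ne'⟩, fun P hP _ => ?_⟩
      exact (hP.1.pow_le_iff ht.ne').1 hP.2
  unfold lenMod
  rw [Module.length_eq_of_surjective (R := R ⧸ maximalIdeal R ^ t) (S := R)
    Ideal.Quotient.mk_surjective]
  have : Module.Finite (R ⧸ maximalIdeal R ^ t) (N ⧸ (maximalIdeal R ^ t • (⊤ : Submodule R N))) :=
    Module.Finite.of_restrictScalars_finite R _ _
  exact Module.length_ne_top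

universe u in
/-- Growth of the Hilbert-Samuel function of a module of dimension at most `d`, and of its
difference function. -/
theorem lenMod_pow_growth (d : ℕ) : ∀ (N : Type u) [AddCommGroup N] [Module R N]
    [Module.Finite R N], Module.supportDim R N ≤ d →
    (∃ C : ℕ, ∀ t, 1 ≤ t → lenMod (maximalIdeal R ^ t) N ≤ (C * t ^ d : ℕ)) ∧
    ∃ C : ℕ, ∃ δ : ℕ → ℕ, ∀ t, 1 ≤ t →
      lenMod (maximalIdeal R ^ (t + 1)) N ≤ lenMod (maximalIdeal R ^ t) N + δ t ∧
        t * δ t ≤ C * t ^ d := by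
  induction d with
  | zero =>
    intro N _ _ _ h
    obtain ⟨c, hc⟩ := exists_pow_smul_top_eq_bot (R := R) (N := N) (by simpa using h)
    obtain ⟨C, hC⟩ := ENat.ne_top_iff_exists.1 (lenMod_pow_ne_top (R := R) N c)
    have hle : ∀ t, lenMod (maximalIdeal R ^ t) N ≤ lenMod (maximalIdeal R ^ c) N := by
      intro t
      refine (lenMod_le_length _).trans ?_
      unfold lenMod
      rw [hc]
      exact (Submodule.quotEquivOfEqBot ⊥ rfl).length_eq.ge
    -- The condition `t * δ t ≤ C * t ^ d` expresses `δ = O(t^(d-1))` in a form that makes sense for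
    -- `d = 0`: there `δ` must vanish eventually, as it does from `c` on because `𝔪^c N = 0`.
    refine ⟨⟨C, fun t _ => by simpa [hC] using hle t⟩, c * C, fun t => if t < c then C else 0,
      fun t _ => ?_⟩
    beta_reduce
    split_ifs with htc
    · refine ⟨?_, by simpa using Nat.mul_le_mul_right C htc.le⟩
      rw [hC]
      exact (hle _).trans le_add_self
    · refine ⟨?_, by simp⟩
      rw [Nat.cast_zero, add_zero]
      exact (hle _).trans (lenMod_anti (Ideal.pow_le_pow_right (not_lt.1 htc)))
  | succ d ih =>
    intro N _ _ _ h
    obtain ⟨c, hcm, hc⟩ := exists_notMem_of_supportDim N d h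
    obtain ⟨⟨C, hC⟩, -⟩ := ih (QuotSMulTop c N) hc
    have hstep : ∀ t, lenMod (maximalIdeal R ^ (t + 1)) N ≤
        lenMod (maximalIdeal R ^ t) N + (C * (t + 1) ^ d : ℕ) := fun t =>
      (lenMod_pow_succ_le N hcm t).trans (add_le_add_right (hC (t + 1) (by omega)) _)
    refine ⟨⟨C, ?_⟩, C * 2 ^ d, fun t => C * (t + 1) ^ d, fun t ht => ⟨hstep t, ?_⟩⟩
    · suffices ∀ t, lenMod (maximalIdeal R ^ t) N ≤ (C * t ^ (d + 1) : ℕ) from fun t _ => this t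
      intro t
      induction t with
      | zero =>
        have : (maximalIdeal R ^ 0) • (⊤ : Submodule R N) = ⊤ := by simp
        unfold lenMod
        rw [this, Module.length_eq_zero]
        exact zero_le
      | succ t iht =>
        refine (hstep t).trans ((add_le_add_left iht _).trans ?_)
        rw [← Nat.cast_add, Nat.cast_le, ← mul_add]
        refine Nat.mul_le_mul_left C ?_
        rw [pow_succ, pow_succ, mul_add_one]
        exact Nat.add_le_add_right (Nat.mul_le_mul_right _ (Nat.pow_le_pow_left (by omega) _)) _
    · calc t * (C * (t + 1) ^ d) ≤ t * (C * (2 * t) ^ d) := by gcongr; omega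
        _ = C * 2 ^ d * t ^ (d + 1) := by rw [mul_pow]; ring

end Growth

/-! ### Bracket powers against ordinary powers -/

section Bracket

variable {R : Type*} [CommRing R] (p : ℕ) [Fact p.Prime] [CharP R p]

theorem bracketPower_eq_map (J : Ideal R) (e : ℕ) :
    bracketPower J (p ^ e) = J.map (iterateFrobenius R p e) := by
  unfold bracketPower Ideal.map
  congr 1

theorem map_iterateFrobenius_le (J : Ideal R) (a e : ℕ) :
    (J ^ a).map (iterateFrobenius R p e) ≤ J ^ (a * p ^ e) := by
  rw [Ideal.map_le_iff_le_comap]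
  intro x hx
  rw [Ideal.mem_comap, iterateFrobenius_def, pow_mul]
  exact Ideal.pow_mem_pow hx _

/-- Pigeonhole: a large power of a finitely generated ideal is the product of a bracket power
and a smaller power. -/
theorem exists_pow_add_le_map_mul (J : Ideal R) (hJ : J.FG) (e : ℕ) :
    ∃ c, J ^ (c + p ^ e) ≤ J.map (iterateFrobenius R p e) * J ^ c := by
  classical
  obtain ⟨s, rfl⟩ := hJ
  -- Among `s.card * q + q` generators one occurs at least `q` times; removing `q` copies leaves
  -- exactly `s.card * q` factors.
  refine ⟨s.card * p ^ e, ?_⟩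
  set q := p ^ e with hq
  have hq0 : 0 < q := pow_pos (Fact.out (p := p.Prime)).pos e
  change Ideal.span (s : Set R) ^ _ ≤ (Ideal.span (s : Set R)).map _ * Ideal.span (s : Set R) ^ _
  conv_lhs => rw [Ideal.span, Submodule.span_pow]
  refine Ideal.span_le.2 ?_
  intro x hx
  obtain ⟨f, rfl⟩ := Set.mem_pow.1 hx
  obtain ⟨y, hy, hcard⟩ := Finset.exists_le_card_fiber_of_mul_le_card_of_maps_to
    (s := (Finset.univ : Finset (Fin (s.card * q + q)))) (t := s) (f := fun i => (f i : R)) (n := q)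
    (fun i _ => (f i).2) (by
      rcases Finset.eq_empty_or_nonempty s with h | h
      · exfalso
        have := (f ⟨0, by omega⟩).2
        simp [h] at this
      · exact h) (by simp)
  obtain ⟨T, hT, hTc⟩ := Finset.exists_subset_card_eq hcard
  rw [List.prod_ofFn, ← Finset.prod_mul_prod_compl T]
  refine Ideal.mul_mem_mul ?_ ?_
  · have : ∏ i ∈ T, (f i : R) = y ^ T.card :=
      Finset.prod_eq_pow_card fun i hi => (Finset.mem_filter.1 (hT hi)).2
    rw [this, hTc, hq, ← iterateFrobenius_def]
    exact Ideal.mem_map_of_mem _ (Ideal.subset_span hy)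
  · have h2 : Tᶜ.card = s.card * q := by
      rw [Finset.card_compl, hTc, Fintype.card_fin]; omega
    have h3 : ∏ i ∈ Tᶜ, (f i : R) ∈ Ideal.span (s : Set R) ^ Tᶜ.card := by
      rw [← Finset.prod_const]
      exact Ideal.prod_mem_prod fun i _ => Ideal.subset_span (f i).2
    rwa [h2] at h3

/-- The constant does not depend on `a`: bracket factors are peeled off one at a time while the same
spare factor `J ^ c` is kept. -/
theorem exists_pow_le_map_pow (J : Ideal R) (hJ : J.FG) (e : ℕ) :
    ∃ c, ∀ a, J ^ (a * p ^ e + c) ≤ (J ^ a).map (iterateFrobenius R p e) := by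
  obtain ⟨c, hc⟩ := exists_pow_add_le_map_mul p J hJ e
  refine ⟨c, fun a => ?_⟩
  suffices J ^ (a * p ^ e + c) ≤ (J ^ a).map (iterateFrobenius R p e) * J ^ c from
    this.trans Ideal.mul_le_left
  induction a with
  | zero => simp [Ideal.map_top]
  | succ a ih =>
    calc J ^ ((a + 1) * p ^ e + c) = J ^ (a * p ^ e + c) * J ^ (p ^ e) := by
          rw [← pow_add]; congr 1; ring
      _ ≤ ((J ^ a).map (iterateFrobenius R p e) * J ^ c) * J ^ (p ^ e) := Ideal.mul_mono_left ih
      _ = (J ^ a).map (iterateFrobenius R p e) * J ^ (c + p ^ e) := by rw [mul_assoc, pow_add]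
      _ ≤ (J ^ a).map (iterateFrobenius R p e) * (J.map (iterateFrobenius R p e) * J ^ c) :=
          Ideal.mul_mono_right hc
      _ = _ := by rw [← mul_assoc, ← Ideal.map_mul, pow_succ]

end Bracket

/-! ### Arithmetic of the exponents `⌈s p^e⌉` -/

section Exponents

variable (p : ℕ) [Fact p.Prime] (s : ℝ)

theorem one_le_ceil (hs : 0 < s) (e : ℕ) : 1 ≤ ⌈s * (p : ℝ) ^ e⌉₊ :=
  Nat.one_le_ceil_iff.2 (mul_pos hs (pow_pos (by exact_mod_cast (Fact.out (p := p.Prime)).pos) e))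

omit [Fact p.Prime] in
theorem ceil_le_mul (e : ℕ) : ⌈s * (p : ℝ) ^ e⌉₊ ≤ ⌈s⌉₊ * p ^ e := by
  rw [Nat.ceil_le]
  push_cast
  exact mul_le_mul_of_nonneg_right (Nat.le_ceil s) (by positivity)

omit [Fact p.Prime] in
theorem le_mul_ceil (hs : 0 < s) (e : ℕ) : p ^ e ≤ ⌈1 / s⌉₊ * ⌈s * (p : ℝ) ^ e⌉₊ := by
  have h1 : (p : ℝ) ^ e = 1 / s * (s * (p : ℝ) ^ e) := by field_simp
  have h2 : (p : ℝ) ^ e ≤ ⌈1 / s⌉₊ * ⌈s * (p : ℝ) ^ e⌉₊ := by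
    conv_lhs => rw [h1]
    exact mul_le_mul (Nat.le_ceil _) (Nat.le_ceil _) (by positivity) (by positivity)
  exact_mod_cast h2

omit [Fact p.Prime] in
theorem ceil_add_le (e k : ℕ) : ⌈s * (p : ℝ) ^ (e + k)⌉₊ ≤ ⌈s * (p : ℝ) ^ e⌉₊ * p ^ k := by
  rw [Nat.ceil_le]
  push_cast
  rw [pow_add, ← mul_assoc]
  exact mul_le_mul_of_nonneg_right (Nat.le_ceil _) (by positivity)

omit [Fact p.Prime] in
theorem ceil_mul_le (hs : 0 < s) (e k : ℕ) :
    ⌈s * (p : ℝ) ^ e⌉₊ * p ^ k ≤ ⌈s * (p : ℝ) ^ (e + k)⌉₊ + p ^ k := by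
  have h1 : (⌈s * (p : ℝ) ^ e⌉₊ : ℝ) ≤ s * (p : ℝ) ^ e + 1 :=
    (Nat.ceil_lt_add_one (by positivity)).le
  have h2 : (⌈s * (p : ℝ) ^ e⌉₊ : ℝ) * (p : ℝ) ^ k ≤
      ⌈s * (p : ℝ) ^ (e + k)⌉₊ + (p : ℝ) ^ k := by
    calc (⌈s * (p : ℝ) ^ e⌉₊ : ℝ) * (p : ℝ) ^ k ≤ (s * (p : ℝ) ^ e + 1) * (p : ℝ) ^ k :=
          mul_le_mul_of_nonneg_right h1 (by positivity)
      _ = s * (p : ℝ) ^ (e + k) + (p : ℝ) ^ k := by rw [pow_add]; ring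
      _ ≤ _ := by gcongr; exact Nat.le_ceil _
  exact_mod_cast h2

end Exponents

/-! ### Error terms of order `p^(e(d-1))` -/

section Small

/-- Sequences of order `O(p ^ (e (d - 1)))`. -/
def IsSmall (p d : ℕ) (f : ℕ → ℕ∞) : Prop :=
  ∃ C : ℕ, ∀ e, f e * (p ^ e : ℕ) ≤ (C * p ^ (e * d) : ℕ)

variable {p d : ℕ} {f g h : ℕ → ℕ∞}

theorem IsSmall.add (hf : IsSmall p d f) (hg : IsSmall p d g) : IsSmall p d (fun e => f e + g e) := by
  obtain ⟨C, hC⟩ := hf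
  obtain ⟨D, hD⟩ := hg
  refine ⟨C + D, fun e => ?_⟩
  rw [add_mul, add_mul, Nat.cast_add]
  exact add_le_add (hC e) (hD e)

/-- Two sequences whose difference is of order `O(p ^ (e (d - 1)))`. -/
def SmallDiff (p d : ℕ) (f g : ℕ → ℕ∞) : Prop :=
  ∃ δ, IsSmall p d δ ∧ (∀ e, f e ≤ g e + δ e) ∧ ∀ e, g e ≤ f e + δ e

theorem SmallDiff.trans (h1 : SmallDiff p d f g) (h2 : SmallDiff p d g h) : SmallDiff p d f h := by
  obtain ⟨δ, hδ, h3, h4⟩ := h1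
  obtain ⟨ε, hε, h5, h6⟩ := h2
  refine ⟨fun e => δ e + ε e, hδ.add hε, fun e => ?_, fun e => ?_⟩
  · exact (h3 e).trans ((add_le_add_left (h5 e) _).trans (by rw [add_assoc, add_comm (ε e)]))
  · exact (h6 e).trans ((add_le_add_left (h4 e) _).trans (by rw [add_assoc]))

end Small

/-! ### Enlarging both ideals of a comparison -/

section Compare

variable {R : Type*} [CommRing R] {N : Type*} [AddCommGroup N] [Module R N]

/-- The gap is the length of `BN / AN`, which maps onto `(B+J)N / (A+J)N`; so adding `J` to both
ideals cannot widen it. Finiteness of `N / BN` is needed to cancel in the hypothesis. -/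
theorem lenMod_sup_le {A B : Ideal R} (J : Ideal R) (hAB : A ≤ B) {δ : ℕ∞}
    (hB : lenMod B N ≠ ⊤) (h : lenMod A N ≤ lenMod B N + δ) :
    lenMod (A ⊔ J) N ≤ lenMod (B ⊔ J) N + δ := by
  have key : ∀ {A B : Ideal R} (hAB : A ≤ B), lenMod A N = lenMod B N + Module.length R
      (LinearMap.ker (Submodule.factor (Submodule.smul_mono_left hAB :
        A • (⊤ : Submodule R N) ≤ B • ⊤))) := by
    intro A B hAB
    rw [add_comm]
    exact Module.length_eq_add_of_exact (Submodule.subtype _) _ (Submodule.subtype_injective _)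
      (Submodule.factor_surjective _) (LinearMap.exact_subtype_ker_map _)
  rw [key hAB] at h
  rw [key (sup_le_sup_right hAB J)]
  refine add_le_add_right (le_trans ?_ ((ENat.add_le_add_iff_left hB).1 h)) _
  have hA : A • (⊤ : Submodule R N) ≤ (A ⊔ J) • ⊤ := Submodule.smul_mono_left le_sup_left
  have hm : ∀ x ∈ LinearMap.ker (Submodule.factor (Submodule.smul_mono_left hAB :
        A • (⊤ : Submodule R N) ≤ B • ⊤)),
      Submodule.factor hA x ∈ LinearMap.ker (Submodule.factor
        (Submodule.smul_mono_left (sup_le_sup_right hAB J) :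
        (A ⊔ J) • (⊤ : Submodule R N) ≤ (B ⊔ J) • ⊤)) := by
    intro x hx
    obtain ⟨x, rfl⟩ := Submodule.mkQ_surjective _ x
    have hx' : x ∈ B • (⊤ : Submodule R N) := by simpa using hx
    have : x ∈ (B ⊔ J) • (⊤ : Submodule R N) := Submodule.smul_mono_left le_sup_left hx'
    simpa using this
  refine Module.length_le_of_surjective ((Submodule.factor hA).restrict hm) ?_
  rintro ⟨y, hy⟩
  obtain ⟨y, rfl⟩ := Submodule.mkQ_surjective _ y
  have hy' : y ∈ (B ⊔ J) • (⊤ : Submodule R N) := by simpa using hy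
  rw [Submodule.sup_smul] at hy'
  obtain ⟨b, hb, j, hj, rfl⟩ := Submodule.mem_sup.1 hy'
  refine ⟨⟨Submodule.mkQ _ b, by simpa using hb⟩, ?_⟩
  ext
  change Submodule.Quotient.mk b = Submodule.Quotient.mk (b + j)
  rw [eq_comm, Submodule.Quotient.eq]
  simpa using (Submodule.smul_mono_left le_sup_right : J • (⊤ : Submodule R N) ≤ (A ⊔ J) • ⊤) hj

end Compare

/-! ### The ideals `I_e` and their behaviour under Frobenius -/

section FrobIdeal

variable {R : Type*} [CommRing R] [IsLocalRing R] (p : ℕ) (s : ℝ)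

variable (R) in
/-- The ideal `𝔪 ^ ⌈s p^e⌉ + 𝔪^[p^e]`. -/
def frobIdeal (e : ℕ) : Ideal R :=
  maximalIdeal R ^ ⌈s * (p : ℝ) ^ e⌉₊ + bracketPower (maximalIdeal R) (p ^ e)

theorem pow_le_frobIdeal (e : ℕ) :
    maximalIdeal R ^ ⌈s * (p : ℝ) ^ e⌉₊ ≤ frobIdeal R p s e := le_sup_left

variable [IsNoetherianRing R]

theorem lenMod_frobIdeal_ne_top (N : Type*) [AddCommGroup N] [Module R N] [Module.Finite R N]
    (e : ℕ) : lenMod (frobIdeal R p s e) N ≠ ⊤ :=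
  ne_top_of_le_ne_top (lenMod_pow_ne_top N _) (lenMod_anti (pow_le_frobIdeal p s e))

variable (N : Type*) [AddCommGroup N] [Module R N] [Module.Finite R N]

theorem lenMod_frobIdeal_le [Fact p.Prime] (hs : 0 < s) {d : ℕ} (h : Module.supportDim R N ≤ d) :
    ∃ C : ℕ, ∀ e, lenMod (frobIdeal R p s e) N ≤ (C * p ^ (e * d) : ℕ) := by
  obtain ⟨⟨C, hC⟩, -⟩ := lenMod_pow_growth d N h
  refine ⟨C * ⌈s⌉₊ ^ d, fun e => (lenMod_anti (pow_le_frobIdeal p s e)).trans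
    ((hC _ (one_le_ceil p s hs e)).trans ?_)⟩
  rw [Nat.cast_le, pow_mul, mul_assoc, ← mul_pow]
  exact Nat.mul_le_mul_left _ (Nat.pow_le_pow_left (ceil_le_mul p s e) _)

theorem isSmall_lenMod [Fact p.Prime] (hs : 0 < s) {d : ℕ} (h : Module.supportDim R N < d) :
    IsSmall p d (fun e => lenMod (frobIdeal R p s e) N) := by
  cases d with
  | zero =>
    -- Dimension below 0 means that the module is zero.
    have : Module.supportDim R N = ⊥ := WithBot.lt_zero_iff_eq_bot _ |>.1 (by simpa using h)
    rw [Module.supportDim_eq_bot_iff_subsingleton] at this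
    exact ⟨0, fun e => by simp [lenMod_eq_zero]⟩
  | succ d =>
    obtain ⟨C, hC⟩ := lenMod_frobIdeal_le p s N hs (d := d)
      (ENat.WithBot.lt_add_one_iff.1 (by simpa using h))
    refine ⟨C, fun e => (mul_le_mul_left (hC e) _).trans ?_⟩
    rw [← Nat.cast_mul, Nat.cast_le]
    exact le_of_eq (by ring)

/-- Each of the `w` unit increases costs `O(a^(d-1))` with `a = ⌈s p^e⌉`; since `a` and `p^e` bound
each other up to constants, this is `O(p^(e(d-1)))`. -/
theorem lenMod_pow_add_le [Fact p.Prime] (hs : 0 < s) {d : ℕ} (h : Module.supportDim R N ≤ d)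
    (w : ℕ) : ∃ δ : ℕ → ℕ∞, IsSmall p d δ ∧ ∀ e,
      lenMod (maximalIdeal R ^ (⌈s * (p : ℝ) ^ e⌉₊ + w)) N ≤
        lenMod (maximalIdeal R ^ ⌈s * (p : ℝ) ^ e⌉₊) N + δ e := by
  obtain ⟨-, C, δ, hδ⟩ := lenMod_pow_growth d N h
  induction w with
  | zero => exact ⟨0, ⟨0, by simp⟩, by simp⟩
  | succ w ih =>
    obtain ⟨ε, hε, h1⟩ := ih
    refine ⟨fun e => ε e + δ (⌈s * (p : ℝ) ^ e⌉₊ + w), hε.add ?_, fun e => ?_⟩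
    · refine ⟨⌈1 / s⌉₊ * (C * (⌈s⌉₊ + w) ^ d), fun e => ?_⟩
      rw [← Nat.cast_mul, Nat.cast_le]
      set a := ⌈s * (p : ℝ) ^ e⌉₊ with ha
      have h2 : a + w ≤ (⌈s⌉₊ + w) * p ^ e := by
        rw [add_mul]
        exact Nat.add_le_add (ceil_le_mul p s e)
          (Nat.le_mul_of_pos_right _ (pow_pos (Fact.out (p := p.Prime)).pos e))
      calc δ (a + w) * p ^ e ≤ δ (a + w) * (⌈1 / s⌉₊ * a) := by gcongr; exact le_mul_ceil p s hs e
        _ ≤ δ (a + w) * (⌈1 / s⌉₊ * (a + w)) := by gcongr; omega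
        _ = ⌈1 / s⌉₊ * ((a + w) * δ (a + w)) := by ring
        _ ≤ ⌈1 / s⌉₊ * (C * (a + w) ^ d) :=
          Nat.mul_le_mul_left _ (hδ (a + w) (by have := one_le_ceil p s hs e; omega)).2
        _ ≤ ⌈1 / s⌉₊ * (C * ((⌈s⌉₊ + w) * p ^ e) ^ d) := by gcongr
        _ = _ := by rw [mul_pow, ← pow_mul]; ring
    · rw [← add_assoc, ← add_assoc]
      exact (hδ _ (by have := one_le_ceil p s hs e; omega)).1.trans (add_le_add_left (h1 e) _)

/-- Replacing the ideal `I_(e + k)` by the bracket power `I_e^[p^k]` changes the length of the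
quotient by `O(p ^ (e (d - 1)))`. -/
theorem smallDiff_map_frobIdeal [Fact p.Prime] [CharP R p] (hs : 0 < s) {d : ℕ}
    (h : Module.supportDim R N ≤ d) (k : ℕ) :
    SmallDiff p d (fun e => lenMod (frobIdeal R p s (e + k)) N)
      (fun e => lenMod ((frobIdeal R p s e).map (iterateFrobenius R p k)) N) := by
  obtain ⟨c, hc⟩ := exists_pow_le_map_pow p (maximalIdeal R) (IsNoetherian.noetherian _) k
  -- Rounding in the ceiling costs at most `p ^ k` in the exponent, the pigeonhole bound a further
  -- `c`.
  obtain ⟨δ, hδ, h1⟩ := lenMod_pow_add_le p s N hs h (p ^ k + c)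
  -- The bracket parts of `I_e^[p^k]` and `I_(e+k)` coincide, so only the ordinary powers have to be
  -- compared.
  have hmap : ∀ e, (frobIdeal R p s e).map (iterateFrobenius R p k) =
      (maximalIdeal R ^ ⌈s * (p : ℝ) ^ e⌉₊).map (iterateFrobenius R p k) ⊔
        bracketPower (maximalIdeal R) (p ^ (e + k)) := by
    intro e
    rw [frobIdeal, Submodule.add_eq_sup, Ideal.map_sup, bracketPower_eq_map, bracketPower_eq_map,
      Ideal.map_map]
    congr 2
    ext x
    simp [iterateFrobenius_def, ← pow_mul, pow_add]
  refine ⟨fun e => δ (e + k), ?_, fun e => ?_, fun e => ?_⟩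
  · obtain ⟨C, hC⟩ := hδ
    refine ⟨C * p ^ (k * d), fun e => ?_⟩
    calc δ (e + k) * (p ^ e : ℕ) ≤ δ (e + k) * (p ^ (e + k) : ℕ) := by
          gcongr
          · exact (Fact.out (p := p.Prime)).pos
          · omega
      _ ≤ _ := hC _
      _ = _ := by congr 1; ring
  · refine (lenMod_anti ?_).trans le_self_add
    rw [hmap]
    refine sup_le_sup_right ((map_iterateFrobenius_le p _ _ k).trans ?_) _
    exact Ideal.pow_le_pow_right (ceil_add_le p s e k)
  · calc lenMod ((frobIdeal R p s e).map (iterateFrobenius R p k)) N ≤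
        lenMod (maximalIdeal R ^ (⌈s * (p : ℝ) ^ (e + k)⌉₊ + (p ^ k + c)) ⊔
          bracketPower (maximalIdeal R) (p ^ (e + k))) N := by
          refine lenMod_anti ?_
          rw [hmap]
          refine sup_le_sup_right (le_trans (Ideal.pow_le_pow_right ?_) (hc _)) _
          have := ceil_mul_le p s hs e k
          omega
      _ ≤ _ := lenMod_sup_le _ (Ideal.pow_le_pow_right (by omega)) (lenMod_pow_ne_top N _)
          (h1 (e + k))

end FrobIdeal

/-! ### Frobenius pushforward of a module -/

section FrobMod

/-- The module `N` with scalars acting through the `k`-th iterate of the Frobenius. -/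
@[nolint unusedArguments]
def FrobMod (_p _k : ℕ) (N : Type*) : Type _ := N

variable {R : Type*} [CommRing R] (p : ℕ) [Fact p.Prime] [CharP R p] (k : ℕ)
variable (N : Type*) [AddCommGroup N] [Module R N]

instance : AddCommGroup (FrobMod p k N) := inferInstanceAs (AddCommGroup N)

instance : Module R (FrobMod p k N) :=
  Module.compHom N (iterateFrobenius R p k)

end FrobMod

section FrobMod

variable {R : Type*} [CommRing R] (p : ℕ) [Fact p.Prime] [CharP R p] (k : ℕ)
variable {N : Type*} [AddCommGroup N] [Module R N]

/-- The identity `N → FrobMod p k N`. -/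
def toFrobMod : N ≃+ FrobMod p k N := AddEquiv.refl N

theorem smul_toFrobMod (r : R) (x : N) :
    r • toFrobMod p k x = toFrobMod p k (iterateFrobenius R p k r • x) := rfl

/-- The extended ideal is spanned by the `p^k`-th powers of elements of `I`. Coefficients of such a
combination are absorbed into the module element, which is why the inner induction generalizes `n`.
-/
theorem mem_smul_top_frobMod (I : Ideal R) (x : N) :
    toFrobMod p k x ∈ I • (⊤ : Submodule R (FrobMod p k N)) ↔
      x ∈ I.map (iterateFrobenius R p k) • (⊤ : Submodule R N) := by
  constructor
  · intro hx
    have : ∀ y ∈ I • (⊤ : Submodule R (FrobMod p k N)), (toFrobMod p k).symm y ∈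
        I.map (iterateFrobenius R p k) • (⊤ : Submodule R N) := by
      intro y hy
      induction hy using Submodule.smul_induction_on' with
      | smul r hr n _ =>
        exact Submodule.smul_mem_smul (Ideal.mem_map_of_mem _ hr) Submodule.mem_top
      | add y _ z _ h1 h2 => rw [map_add]; exact Submodule.add_mem _ h1 h2
    exact this _ hx
  · intro hx
    induction hx using Submodule.smul_induction_on' with
    | smul r hr n _ =>
      induction hr using Submodule.span_induction generalizing n with
      | mem y hy =>
        obtain ⟨r, hr, rfl⟩ := hy
        exact Submodule.smul_mem_smul (N := (⊤ : Submodule R (FrobMod p k N))) hr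
          (Submodule.mem_top (x := toFrobMod p k n))
      | zero => rw [zero_smul, map_zero]; exact Submodule.zero_mem _
      | add y z _ _ h1 h2 =>
        rw [add_smul, map_add]
        exact Submodule.add_mem _ (h1 n trivial) (h2 n trivial)
      | smul b y _ h1 =>
        rw [smul_eq_mul, mul_comm, mul_smul]
        exact h1 _ trivial
    | add y _ z _ h1 h2 => rw [map_add]; exact Submodule.add_mem _ h1 h2

theorem length_compHom_eq {A B : Type*} [CommRing A] [CommRing B] [IsLocalRing B] (φ : A →+* B)
    (hs : ∀ b : B, ∃ a : A, b - φ a ∈ maximalIdeal B) (X : Type*) [AddCommGroup X] [Module B X] :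
    @Module.length A X _ _ (Module.compHom X φ) = Module.length B X := by
  let _ := φ.toAlgebra
  let _ := Module.compHom X φ
  have : IsScalarTower A B X := ⟨fun r x y => mul_smul (φ r) x y⟩
  exact length_eq_of_residue_surjective hs X

theorem finite_compHom {A B : Type*} [CommRing A] [CommRing B] (φ : A →+* B) (hφ : φ.Finite)
    (X : Type*) [AddCommGroup X] [Module B X] [Module.Finite B X] :
    @Module.Finite A X _ _ (Module.compHom X φ) := by
  let _ := φ.toAlgebra
  let _ := Module.compHom X φ
  have : IsScalarTower A B X := ⟨fun r x y => mul_smul (φ r) x y⟩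
  have : Module.Finite A B := hφ
  exact Module.Finite.trans B X

/-- The quotient of the pushforward is the pushforward of `N / I^[p^k] N`, and restriction along
Frobenius preserves length because the residue field is perfect, which is what `hres` says. -/
theorem lenMod_frobMod [IsLocalRing R]
    (hres : ∀ b : R, ∃ a : R, b - a ^ p ∈ maximalIdeal R) (I : Ideal R) :
    lenMod I (FrobMod p k N) = lenMod (I.map (iterateFrobenius R p k)) N := by
  set J := I.map (iterateFrobenius R p k) • (⊤ : Submodule R N) with hJ
  let π : FrobMod p k N →ₗ[R] FrobMod p k (N ⧸ J) :=
    { toFun := fun x => toFrobMod p k (J.mkQ ((toFrobMod p k).symm x))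
      map_add' := fun x y => by simp
      map_smul' := fun r x => rfl }
  have hπ : Function.Surjective π := fun y =>
    let ⟨x, hx⟩ := J.mkQ_surjective ((toFrobMod p k).symm y)
    ⟨toFrobMod p k x, hx⟩
  have hker : LinearMap.ker π = I • ⊤ := by
    ext x
    obtain ⟨x, rfl⟩ := (toFrobMod p k).surjective x
    rw [mem_smul_top_frobMod, ← hJ, LinearMap.mem_ker]
    exact (Submodule.Quotient.mk_eq_zero J)
  have h1 : lenMod I (FrobMod p k N) = Module.length R (FrobMod p k (N ⧸ J)) := by
    unfold lenMod
    rw [← hker]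
    exact (π.quotKerEquivOfSurjective hπ).length_eq
  rw [h1]
  have hres' : ∀ k : ℕ, ∀ b : R, ∃ a : R, b - iterateFrobenius R p k a ∈ maximalIdeal R := by
    intro k
    induction k with
    | zero => exact fun b => ⟨b, by simp⟩
    | succ k ih =>
      intro b
      obtain ⟨a, ha⟩ := hres b
      obtain ⟨c, hc⟩ := ih a
      refine ⟨c, ?_⟩
      have h2 : b - iterateFrobenius R p (k + 1) c =
          (b - a ^ p) + (a - iterateFrobenius R p k c) ^ p := by
        rw [sub_pow_char, iterateFrobenius_def, iterateFrobenius_def, ← pow_mul, ← pow_succ]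
        ring
      rw [h2]
      exact Ideal.add_mem _ ha (Ideal.pow_mem_of_mem _ hc _ (Fact.out (p := p.Prime)).pos)
  exact length_compHom_eq (iterateFrobenius R p k) (hres' k) (N ⧸ J)

theorem frobMod_finite (hfin : (frobenius R p).Finite) [Module.Finite R N] :
    Module.Finite R (FrobMod p k N) := by
  have h1 : ∀ k, (iterateFrobenius R p k).Finite := by
    intro k
    induction k with
    | zero => rw [iterateFrobenius_zero]; exact RingHom.Finite.id R
    | succ k ih =>
      have : iterateFrobenius R p (k + 1) = (frobenius R p).comp (iterateFrobenius R p k) := by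
        ext x
        simp [iterateFrobenius_def, frobenius_def, pow_succ, pow_mul]
      rw [this]
      exact hfin.comp ih
  exact finite_compHom (iterateFrobenius R p k) (h1 k) N

theorem annihilator_le_frobMod :
    Module.annihilator R N ≤ Module.annihilator R (FrobMod p k N) := by
  intro r hr
  rw [Module.mem_annihilator] at hr ⊢
  intro x
  obtain ⟨x, rfl⟩ := (toFrobMod p k).surjective x
  rw [smul_toFrobMod, iterateFrobenius_def]
  have : r ^ p ^ k = r ^ (p ^ k - 1) * r := by
    rw [← pow_succ, Nat.sub_add_cancel (pow_pos (Fact.out (p := p.Prime)).pos k)]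
  rw [this, mul_smul, hr, smul_zero, map_zero]

/-- Some power of the radical lies in the annihilator, so a high enough pushforward is a module over
a reduced quotient of `R`, where generic decomposition is available. -/
theorem exists_radical_le_annihilator_frobMod [IsNoetherianRing R] :
    ∃ k, (Module.annihilator R N).radical ≤ Module.annihilator R (FrobMod p k N) := by
  obtain ⟨n, hn⟩ := Ideal.exists_radical_pow_le_of_fg (Module.annihilator R N)
    (IsNoetherian.noetherian _)
  obtain ⟨k, hk⟩ := (Nat.lt_pow_self (Fact.out (p := p.Prime)).one_lt : n < p ^ n) |>.le |>
    fun h => (⟨n, h⟩ : ∃ k, n ≤ p ^ k)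
  refine ⟨k, fun r hr => ?_⟩
  rw [Module.mem_annihilator]
  intro x
  obtain ⟨x, rfl⟩ := (toFrobMod p k).surjective x
  rw [smul_toFrobMod, iterateFrobenius_def]
  have : r ^ p ^ k ∈ Module.annihilator R N :=
    hn (Ideal.pow_le_pow_right hk (Ideal.pow_mem_pow hr _))
  rw [Module.mem_annihilator.1 this, map_zero]

end FrobMod

/-! ### Generic decomposition over a reduced quotient -/

section Devissage

variable {R : Type*} [CommRing R] [IsNoetherianRing R]

omit [IsNoetherianRing R] in
theorem supportDim_le_of_annihilator_le {N N' : Type*} [AddCommGroup N] [Module R N]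
    [Module.Finite R N] [AddCommGroup N'] [Module R N'] [Module.Finite R N']
    (h : Module.annihilator R N ≤ Module.annihilator R N') :
    Module.supportDim R N' ≤ Module.supportDim R N := by
  rw [Module.supportDim_eq_ringKrullDim_quotient_annihilator,
    Module.supportDim_eq_ringKrullDim_quotient_annihilator]
  exact ringKrullDim_le_of_surjective (Ideal.Quotient.factor h) (Ideal.Quotient.factor_surjective h)

omit [IsNoetherianRing R] in
open Pointwise in
-- `T` is a module over `R / (I + (c))`, and killing an element outside all minimal primes of `I`
-- lowers the dimension of `R / I`.
theorem supportDim_lt_of_mem_annihilator {T : Type*} [AddCommGroup T] [Module R T]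
    [Module.Finite R T] {I : Ideal R} {d : ℕ} (hd : Module.supportDim R (R ⧸ I) ≤ d)
    (hI : I ≤ Module.annihilator R T) {c : R} (hc : c ∈ Module.annihilator R T)
    (hcI : ∀ Q ∈ I.minimalPrimes, c ∉ Q) : Module.supportDim R T < d := by
  have h1 := Module.supportDim_quotSMulTop_succ_le_of_notMem_minimalPrimes (M := R ⧸ I) (x := c)
    (by rwa [Ideal.annihilator_quotient])
  refine lt_of_le_of_lt (supportDim_le_of_annihilator_le (N := QuotSMulTop c (R ⧸ I)) ?_)
    (ENat.WithBot.add_one_le_natCast_iff.1 (h1.trans hd))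
  intro r hr
  have h2 := Module.mem_annihilator.1 hr (Submodule.Quotient.mk (Ideal.Quotient.mk I 1))
  rw [← Submodule.Quotient.mk_smul, Submodule.Quotient.mk_eq_zero,
    Submodule.mem_smul_pointwise_iff_exists] at h2
  obtain ⟨b, -, hb⟩ := h2
  obtain ⟨b, rfl⟩ := Ideal.Quotient.mk_surjective b
  have h3 : c * b - r ∈ I := by
    rw [← Ideal.Quotient.eq]
    simpa [Algebra.smul_def] using hb
  have h4 : r = c * b - (c * b - r) := by ring
  rw [h4]
  exact Ideal.sub_mem _ (Ideal.mul_mem_right _ _ hc) (hI h3)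

end Devissage

section Filtration

variable {R : Type*} [CommRing R] [IsNoetherianRing R]

theorem exists_notMem_forall_minimalPrimes {I A : Ideal R}
    (h : ∀ Q ∈ I.minimalPrimes, ¬ A ≤ Q) : ∃ c ∈ A, ∀ Q ∈ I.minimalPrimes, c ∉ Q := by
  have hfin := Ideal.finite_minimalPrimes_of_isNoetherianRing R I
  have : ¬ ((A : Set R) ⊆
      ⋃ P ∈ (hfin.toFinset : Set (Ideal R)), ((id P : Ideal R) : Set R)) := by
    rw [Ideal.subset_union_prime ⊥ ⊥]
    · rintro ⟨P, hP, hle⟩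
      exact h P (hfin.mem_toFinset.1 hP) hle
    · intro P hP _ _
      exact (hfin.mem_toFinset.1 hP).1.1
  obtain ⟨c, hc, hc'⟩ := Set.not_subset.1 this
  refine ⟨c, hc, fun Q hQ hcQ => hc' ?_⟩
  simp only [Set.mem_iUnion]
  exact ⟨Q, hfin.mem_toFinset.2 hQ, hcQ⟩

/-- Take `b` in every minimal prime except `Q`: then `q * b` lies in all of them, hence in the
radical ideal `I`. Thus `b • y` spans a quotient of `R ⧸ Q` in any module killed by `I`. -/
theorem exists_mul_mem_of_minimalPrimes {I Q : Ideal R} (hI : I.IsRadical)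
    (hQ : Q ∈ I.minimalPrimes) : ∃ b, b ∉ Q ∧ ∀ q ∈ Q, q * b ∈ I := by
  have hfin := Ideal.finite_minimalPrimes_of_isNoetherianRing R I
  classical
  have h1 : ¬ ((hfin.toFinset.erase Q).inf id ≤ Q) := by
    intro h
    obtain ⟨P, hP, hPQ⟩ := (Ideal.IsPrime.inf_le' hQ.1.1).1 h
    rw [Finset.mem_erase] at hP
    have hP2 := hfin.mem_toFinset.1 hP.2
    exact hP.1 (le_antisymm hPQ (hQ.2 hP2.1 hPQ))
  obtain ⟨b, hb, hbQ⟩ := SetLike.not_le_iff_exists.1 h1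
  refine ⟨b, hbQ, fun q hq => ?_⟩
  rw [← hI.radical, ← Ideal.sInf_minimalPrimes, Ideal.mem_sInf]
  intro P hP
  by_cases hPQ : P = Q
  · exact hPQ ▸ Ideal.mul_mem_right _ _ hq
  · refine Ideal.mul_mem_left _ _ ?_
    rw [Submodule.mem_finsetInf] at hb
    exact hb P (Finset.mem_erase.2 ⟨hPQ, hfin.mem_toFinset.2 hP⟩)

/-- A finitely generated module killed by a radical ideal `I` agrees generically with a direct sum
of modules `R ⧸ Q`, `Q` a minimal prime of `I`. -/
theorem exists_generic_submodule (N : Type*) [AddCommGroup N] [Module R N] [Module.Finite R N]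
    {I : Ideal R} (hI : I.IsRadical) (hN : I ≤ Module.annihilator R N) :
    ∃ (ι : Type) (_ : Fintype ι) (Q : ι → Ideal R) (W : Submodule R N) (c : R),
      (∀ i, Q i ∈ I.minimalPrimes) ∧ Nonempty (W ≃ₗ[R] ∀ i, R ⧸ Q i) ∧
      (∀ P ∈ I.minimalPrimes, c ∉ P) ∧ ∀ x : N, c • x ∈ W := by
  -- `W` is chosen maximal among the submodules that are finite direct sums of modules `R ⧸ Q`.
  set 𝒲 : Set (Submodule R N) := {W | ∃ (ι : Type) (_ : Fintype ι) (Q : ι → Ideal R),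
    (∀ i, Q i ∈ I.minimalPrimes) ∧ Nonempty (W ≃ₗ[R] ∀ i, R ⧸ Q i)} with h𝒲
  have hne : 𝒲.Nonempty :=
    ⟨⊥, Empty, inferInstance, Empty.elim, fun i => i.elim, ⟨LinearEquiv.ofSubsingleton _ _⟩⟩
  obtain ⟨W, ⟨ι, hι, Q, hQ, ⟨eW⟩⟩, hmax⟩ :=
    WellFounded.has_min (wellFounded_gt : WellFounded ((· > ·) : Submodule R N → _ → Prop)) 𝒲 hne
  -- If no multiple of `y` by an element outside `P` were in `W`, then `b • y` would span a copy of
  -- `R ⧸ P` meeting `W` trivially, and adding it would contradict maximality.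
  have key : ∀ P ∈ I.minimalPrimes, ∀ y : N, ∃ a, a ∉ P ∧ a • y ∈ W := by
    intro P hP y
    by_contra! hcon
    obtain ⟨b, hbP, hb⟩ := exists_mul_mem_of_minimalPrimes hI hP
    let f : (R ⧸ P) →ₗ[R] N := Submodule.liftQ P (LinearMap.toSpanSingleton R N (b • y)) (by
      intro q hq
      rw [LinearMap.mem_ker, LinearMap.toSpanSingleton_apply, smul_smul]
      exact Module.mem_annihilator.1 (hN (hb q hq)) y)
    have hf : ∀ a : R, f (Ideal.Quotient.mk P a) = (a * b) • y := fun a => by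
      rw [mul_smul]; rfl
    have hmem : ∀ a : R, f (Ideal.Quotient.mk P a) ∈ W → a ∈ P := by
      intro a ha
      by_contra haP
      rw [hf] at ha
      exact hcon _ (fun h => (hP.1.1.mem_or_mem h).elim haP hbP) ha
    let g : (W × (R ⧸ P)) →ₗ[R] N := W.subtype.coprod f
    have hg : Function.Injective g := by
      rw [← LinearMap.ker_eq_bot, LinearMap.ker_eq_bot']
      rintro ⟨w, z⟩ hwz
      obtain ⟨a, rfl⟩ := Ideal.Quotient.mk_surjective z
      have h1 : (w : N) + f (Ideal.Quotient.mk P a) = 0 := by simpa [g] using hwz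
      have h2 : a ∈ P := hmem a (by
        rw [eq_neg_of_add_eq_zero_right h1]
        exact W.neg_mem w.2)
      have h3 : Ideal.Quotient.mk P a = 0 := Ideal.Quotient.eq_zero_iff_mem.2 h2
      rw [h3, map_zero, add_zero] at h1
      rw [h3]
      ext
      · simpa using h1
      · rfl
    refine hmax (LinearMap.range g) ⟨Option ι, inferInstance, fun o => o.elim P Q, ?_, ?_⟩ ?_
    · rintro (_ | i)
      · exact hP
      · exact hQ i
    · refine ⟨(LinearEquiv.ofInjective g hg).symm ≪≫ₗ
        (LinearEquiv.prodComm R _ _ ≪≫ₗ (LinearEquiv.prodCongr (LinearEquiv.refl R _) eW)) ≪≫ₗ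
        (LinearEquiv.piOptionEquivProd R (M := fun o : Option ι => R ⧸ (o.elim P Q : Ideal R))).symm⟩
    · refine lt_of_le_of_ne (fun w hw => ⟨(⟨w, hw⟩, 0), by simp [g]⟩) fun h => ?_
      have h4 : f (Ideal.Quotient.mk P 1) ∈ W := by
        rw [h]
        exact ⟨(0, Ideal.Quotient.mk P 1), by simp [g]⟩
      exact hP.1.1.ne_top ((Ideal.eq_top_iff_one _).2 (hmem 1 h4))
  -- For each `P`, the product of the multipliers of finitely many generators annihilates `N ⧸ W`
  -- and is outside `P`; prime avoidance then gives one `c` for all `P`.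
  obtain ⟨c, hc, hcP⟩ := exists_notMem_forall_minimalPrimes
    (I := I) (A := Module.annihilator R (N ⧸ W)) (by
      intro P hP hle
      obtain ⟨S, hS⟩ := Module.Finite.fg_top (R := R) (M := N)
      choose a ha haW using key P hP
      have h1 : ∏ y ∈ S, a y ∈ Module.annihilator R (N ⧸ W) := by
        rw [Module.mem_annihilator]
        intro z
        obtain ⟨z, rfl⟩ := W.mkQ_surjective z
        rw [← map_smul, Submodule.mkQ_apply, Submodule.Quotient.mk_eq_zero]
        have hz : z ∈ Submodule.span R (S : Set N) := by rw [hS]; trivial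
        induction hz using Submodule.span_induction with
        | mem y hy =>
          classical
          rw [← Finset.prod_erase_mul S _ hy, mul_smul]
          exact W.smul_mem _ (haW y)
        | zero => rw [smul_zero]; exact W.zero_mem
        | add y z _ _ h1 h2 => rw [smul_add]; exact W.add_mem h1 h2
        | smul r y _ h1 => rw [smul_comm]; exact W.smul_mem _ h1
      have := hP.1.1
      obtain ⟨y, -, hy⟩ := (Ideal.IsPrime.prod_mem_iff).1 (hle h1)
      exact ha y hy)
  refine ⟨ι, hι, Q, W, c, hQ, ⟨eW⟩, hcP, fun x => ?_⟩
  have := Module.mem_annihilator.1 hc (W.mkQ x)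
  rwa [← map_smul, Submodule.mkQ_apply, Submodule.Quotient.mk_eq_zero] at this

variable [IsLocalRing R] (p : ℕ) [Fact p.Prime] (s : ℝ)

/-- The inclusion `W → N` and multiplication by `c`, `N → W`, both have cokernels killed by `I` and
`c`, hence of dimension below `d`. They bound the lengths in both directions. -/
theorem exists_smallDiff_sum (hs : 0 < s) (N : Type*) [AddCommGroup N] [Module R N]
    [Module.Finite R N] {I : Ideal R} (hI : I.IsRadical) (hN : I ≤ Module.annihilator R N) {d : ℕ}
    (hd : Module.supportDim R (R ⧸ I) ≤ d) :
    ∃ (ι : Type) (_ : Fintype ι) (Q : ι → Ideal R), (∀ i, Q i ∈ I.minimalPrimes) ∧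
      SmallDiff p d (fun e => lenMod (frobIdeal R p s e) N)
        (fun e => ∑ i, lenMod (frobIdeal R p s e) (R ⧸ Q i)) := by
  obtain ⟨ι, hι, Q, W, c, hQ, ⟨eW⟩, hc, hcW⟩ := exists_generic_submodule N hI hN
  let g : N →ₗ[R] W := (LinearMap.lsmul R N c).codRestrict W hcW
  have h1 : Module.supportDim R (N ⧸ LinearMap.range W.subtype) < d := by
    refine supportDim_lt_of_mem_annihilator hd (c := c) ?_ ?_ hc
    · exact hN.trans (LinearMap.annihilator_le_of_surjective _ (Submodule.mkQ_surjective _))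
    · rw [Module.mem_annihilator]
      intro z
      obtain ⟨z, rfl⟩ := Submodule.mkQ_surjective _ z
      rw [← map_smul, Submodule.mkQ_apply, Submodule.Quotient.mk_eq_zero, Submodule.range_subtype]
      exact hcW z
  have h2 : Module.supportDim R (W ⧸ LinearMap.range g) < d := by
    refine supportDim_lt_of_mem_annihilator hd (c := c) ?_ ?_ hc
    · exact (hN.trans (LinearMap.annihilator_le_of_injective _ W.subtype_injective)).trans
        (LinearMap.annihilator_le_of_surjective _ (Submodule.mkQ_surjective _))
    · rw [Module.mem_annihilator]
      intro z
      obtain ⟨z, rfl⟩ := Submodule.mkQ_surjective _ z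
      rw [← map_smul, Submodule.mkQ_apply, Submodule.Quotient.mk_eq_zero]
      exact ⟨z, rfl⟩
  refine ⟨ι, hι, Q, hQ, _, (isSmall_lenMod p s _ hs h1).add (isSmall_lenMod p s _ hs h2),
    fun e => ?_, fun e => ?_⟩
  · beta_reduce
    rw [← lenMod_pi, ← lenMod_congr _ eW]
    exact (lenMod_le_add _ W.subtype).trans (add_le_add_right le_self_add _)
  · beta_reduce
    rw [← lenMod_pi, ← lenMod_congr _ eW]
    exact (lenMod_le_add _ g).trans (add_le_add_right le_add_self _)

end Filtration

/-! ### Convergence of almost geometric sequences -/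

section Sequences

/-- A bounded sequence satisfying `a (e + 1) = μ a e + O(r ^ e)` with `r < 1` converges. -/
theorem exists_tendsto_of_recurrence {a : ℕ → ℝ} {μ B C r : ℝ} (hμ : 0 ≤ μ) (hB : ∀ e, |a e| ≤ B)
    (hr0 : 0 ≤ r) (hr1 : r < 1) (h : ∀ e, |a (e + 1) - μ * a e| ≤ C * r ^ e) :
    ∃ L, Tendsto a atTop (𝓝 L) := by
  have hC : 0 ≤ C := by simpa using (abs_nonneg _).trans (h 0)
  have hgeo : ∀ n, ∑ e ∈ Finset.range n, C * r ^ e ≤ C / (1 - r) := by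
    intro n
    have h1 := (summable_geometric_of_lt_one hr0 hr1).sum_le_tsum (Finset.range n)
      (fun i _ => pow_nonneg hr0 i)
    rw [tsum_geometric_of_lt_one hr0 hr1] at h1
    rw [← Finset.mul_sum, div_eq_mul_inv]
    exact mul_le_mul_of_nonneg_left h1 hC
  -- For `μ ≠ 1` summing the recurrence bounds `∑ |a e|`, so the limit is 0; only `μ = 1` needs the
  -- Cauchy criterion.
  have of_sum : ∀ c, (∀ n, ∑ e ∈ Finset.range n, |a e| ≤ c) → ∃ L, Tendsto a atTop (𝓝 L) := by
    intro c hc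
    have := (summable_of_sum_range_le (fun e => abs_nonneg (a e)) hc).of_abs
    exact ⟨0, this.tendsto_atTop_zero⟩
  have hsum : ∀ n, ∑ e ∈ Finset.range n, |a (e + 1)| =
      ∑ e ∈ Finset.range n, |a e| + |a n| - |a 0| := by
    intro n
    have h1 := Finset.sum_range_succ (fun e => |a e|) n
    have h2 := Finset.sum_range_succ' (fun e => |a e|) n
    linarith
  rcases lt_trichotomy μ 1 with hlt | rfl | hgt
  · refine of_sum ((B + C / (1 - r)) / (1 - μ)) fun n => ?_
    rw [le_div_iff₀ (by linarith)]
    have h1 : ∑ e ∈ Finset.range n, |a (e + 1)| ≤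
        ∑ e ∈ Finset.range n, (μ * |a e| + C * r ^ e) := by
      refine Finset.sum_le_sum fun e _ => ?_
      have := abs_sub_abs_le_abs_sub (a (e + 1)) (μ * a e)
      rw [abs_mul, abs_of_nonneg hμ] at this
      linarith [h e]
    rw [Finset.sum_add_distrib, ← Finset.mul_sum, hsum] at h1
    have := abs_nonneg (a n)
    linarith [hgeo n, hB 0]
  · refine cauchySeq_tendsto_of_complete (cauchySeq_of_le_geometric r C hr1 fun e => ?_)
    rw [dist_comm, Real.dist_eq]
    simpa using h e
  · refine of_sum ((B + C / (1 - r)) / (μ - 1)) fun n => ?_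
    rw [le_div_iff₀ (by linarith)]
    have h1 : ∑ e ∈ Finset.range n, μ * |a e| ≤
        ∑ e ∈ Finset.range n, (|a (e + 1)| + C * r ^ e) := by
      refine Finset.sum_le_sum fun e _ => ?_
      have := abs_sub_abs_le_abs_sub (μ * a e) (a (e + 1))
      rw [abs_mul, abs_of_nonneg hμ, abs_sub_comm] at this
      linarith [h e]
    rw [Finset.sum_add_distrib, ← Finset.mul_sum, hsum] at h1
    have := abs_nonneg (a 0)
    linarith [hgeo n, hB n]

theorem SmallDiff.exists_abs_sub_le {p d : ℕ} (hp : 0 < p) {f g : ℕ → ℕ∞} (h : SmallDiff p d f g)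
    (hf : ∀ e, f e ≠ ⊤) (hg : ∀ e, g e ≠ ⊤) :
    ∃ C : ℝ, ∀ e, |((f e).toNat / (p : ℝ) ^ (e * d) : ℝ) - (g e).toNat / (p : ℝ) ^ (e * d)| ≤
      C * (1 / p : ℝ) ^ e := by
  obtain ⟨δ, ⟨C, hC⟩, h1, h2⟩ := h
  refine ⟨C, fun e => ?_⟩
  have hδ : δ e ≠ ⊤ := by
    intro htop
    have := hC e
    rw [htop, ENat.top_mul (by exact_mod_cast (pow_pos hp e).ne')] at this
    exact ENat.natCast_ne_top _ (top_le_iff.1 this)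
  obtain ⟨a, ha⟩ := ENat.ne_top_iff_exists.1 (hf e)
  obtain ⟨b, hb⟩ := ENat.ne_top_iff_exists.1 (hg e)
  obtain ⟨c, hc⟩ := ENat.ne_top_iff_exists.1 hδ
  have h1 := h1 e
  have h2 := h2 e
  have hC := hC e
  rw [← ha, ← hb, ← hc] at h1 h2
  rw [← hc] at hC
  rw [← ha, ← hb, ENat.toNat_natCast, ENat.toNat_natCast]
  have h1' : (a : ℝ) ≤ b + c := by exact_mod_cast h1
  have h2' : (b : ℝ) ≤ a + c := by exact_mod_cast h2
  have hC' : (c : ℝ) * (p : ℝ) ^ e ≤ C * (p : ℝ) ^ (e * d) := by exact_mod_cast hC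
  have hp' : (0 : ℝ) < p := by exact_mod_cast hp
  rw [← sub_div, abs_div, abs_of_pos (pow_pos hp' (e * d)), div_le_iff₀ (pow_pos hp' _)]
  have h3 : |(a : ℝ) - b| ≤ c := abs_sub_le_iff.2 ⟨by linarith, by linarith⟩
  refine h3.trans ?_
  rw [one_div, inv_pow, mul_assoc, mul_comm ((p : ℝ) ^ e)⁻¹, ← mul_assoc, ← div_eq_mul_inv,
    le_div_iff₀ (pow_pos hp' _)]
  exact hC'

theorem SmallDiff.tendsto_sub {p d : ℕ} (hp : 1 < p) {f g : ℕ → ℕ∞} (h : SmallDiff p d f g)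
    (hf : ∀ e, f e ≠ ⊤) (hg : ∀ e, g e ≠ ⊤) :
    Tendsto (fun e => ((f e).toNat / (p : ℝ) ^ (e * d) : ℝ) - (g e).toNat / (p : ℝ) ^ (e * d))
      atTop (𝓝 0) := by
  obtain ⟨C, hC⟩ := h.exists_abs_sub_le (by omega) hf hg
  refine squeeze_zero_norm hC ?_
  have : Tendsto (fun e : ℕ => (1 / p : ℝ) ^ e) atTop (𝓝 0) := by
    have hp' : (1 : ℝ) < p := by exact_mod_cast hp
    refine tendsto_pow_atTop_nhds_zero_of_lt_one (by positivity) ?_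
    rw [div_lt_one (by linarith)]
    exact hp'
  simpa using this.const_mul C

end Sequences

/-! ### The limit for finite Frobenius and perfect residue field -/

section Limit

variable {R : Type*} [CommRing R] [IsNoetherianRing R] [IsLocalRing R] (p : ℕ) [Fact p.Prime]
  [CharP R p] (s : ℝ)

/-- The pushforward of `R ⧸ Q` agrees generically with some number of copies of `R ⧸ Q`. This gives
the recurrence with `μ` that number over `p ^ d`; its value is never needed. -/
theorem exists_tendsto_prime (hs : 0 < s) (hfin : (frobenius R p).Finite)
    (hres : ∀ b : R, ∃ a : R, b - a ^ p ∈ maximalIdeal R) (Q : Ideal R) [Q.IsPrime] {d : ℕ}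
    (hd : Module.supportDim R (R ⧸ Q) ≤ d) :
    ∃ L : ℝ, Tendsto (fun e => ((lenMod (frobIdeal R p s e) (R ⧸ Q)).toNat : ℝ) / (p : ℝ) ^ (e * d))
      atTop (𝓝 L) := by
  have hp := (Fact.out (p := p.Prime))
  have hp' : (1 : ℝ) < p := by exact_mod_cast hp.one_lt
  set a : ℕ → ℝ := fun e => ((lenMod (frobIdeal R p s e) (R ⧸ Q)).toNat : ℝ) / (p : ℝ) ^ (e * d)
    with ha
  have := frobMod_finite (R := R) p 1 (N := R ⧸ Q) hfin
  have h1 := smallDiff_map_frobIdeal p s (R ⧸ Q) hs hd 1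
  simp_rw [← lenMod_frobMod p 1 hres] at h1
  obtain ⟨ι, hι, P, hP, h2⟩ := exists_smallDiff_sum p s hs (FrobMod p 1 (R ⧸ Q)) (I := Q)
    (Ideal.IsPrime.isRadical ‹_›)
    (Ideal.annihilator_quotient.ge.trans (annihilator_le_frobMod p 1)) hd
  obtain rfl : P = fun _ => Q := funext fun i => by
    have := hP i
    rwa [Ideal.minimalPrimes_eq_subsingleton_self, Set.mem_singleton_iff] at this
  have h3 := h1.trans h2
  have hfin' : ∀ e, lenMod (frobIdeal R p s e) (R ⧸ Q) ≠ ⊤ :=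
    fun e => lenMod_frobIdeal_ne_top p s _ e
  obtain ⟨C, hC⟩ := h3.exists_abs_sub_le hp.pos (fun e => hfin' (e + 1))
    (fun e => by
      rw [ne_eq, ENat.sum_eq_top]
      rintro ⟨i, -, h⟩
      exact hfin' e h)
  obtain ⟨B, hB⟩ := lenMod_frobIdeal_le p s (R ⧸ Q) hs hd
  have hpd : (0 : ℝ) < (p : ℝ) ^ d := pow_pos (by linarith) d
  refine exists_tendsto_of_recurrence (a := a) (μ := Fintype.card ι / (p : ℝ) ^ d) (B := B)
    (C := C / (p : ℝ) ^ d) (r := 1 / p)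
    (by positivity) (fun e => ?_) (by positivity) (by rw [div_lt_one (by linarith)]; exact hp')
    fun e => ?_
  · have hpe : (0 : ℝ) < (p : ℝ) ^ (e * d) := pow_pos (by linarith) _
    rw [abs_of_nonneg (by positivity), ha, div_le_iff₀ hpe]
    have := ENat.toNat_le_of_le_natCast (hB e)
    exact_mod_cast this
  · have h4 := hC e
    have h5 : (((∑ i : ι, lenMod (frobIdeal R p s e) (R ⧸ Q)).toNat : ℕ) : ℝ) =
        Fintype.card ι * (lenMod (frobIdeal R p s e) (R ⧸ Q)).toNat := by
      simp [ENat.toNat_mul]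
    rw [h5] at h4
    have h6 : a (e + 1) - Fintype.card ι / (p : ℝ) ^ d * a e =
        (((lenMod (frobIdeal R p s (e + 1)) (R ⧸ Q)).toNat : ℝ) / (p : ℝ) ^ (e * d) -
        Fintype.card ι * (lenMod (frobIdeal R p s e) (R ⧸ Q)).toNat / (p : ℝ) ^ (e * d)) /
          (p : ℝ) ^ d := by
      simp only [ha]
      rw [add_mul, one_mul, pow_add]
      field_simp
    rw [h6, abs_div, abs_of_pos hpd, div_mul_eq_mul_div]
    exact div_le_div_of_nonneg_right h4 hpd.le

/-- Existence of the limit over a Noetherian local ring with finite Frobenius and perfect residue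
field. -/
theorem exists_tendsto_of_frobenius_finite (hs : 0 < s) (hfin : (frobenius R p).Finite)
    (hres : ∀ b : R, ∃ a : R, b - a ^ p ∈ maximalIdeal R) (N : Type*) [AddCommGroup N]
    [Module R N] [Module.Finite R N] {d : ℕ} (hd : Module.supportDim R N ≤ d) :
    ∃ L : ℝ, Tendsto (fun e => ((lenMod (frobIdeal R p s e) N).toNat : ℝ) / (p : ℝ) ^ (e * d))
      atTop (𝓝 L) := by
  have hp := (Fact.out (p := p.Prime))
  have hp' : (0 : ℝ) < p := by exact_mod_cast hp.pos
  obtain ⟨k, hk⟩ := exists_radical_le_annihilator_frobMod (R := R) p (N := N)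
  have := frobMod_finite (R := R) p k (N := N) hfin
  have h1 := smallDiff_map_frobIdeal p s N hs hd k
  simp_rw [← lenMod_frobMod p k hres] at h1
  have hI : Module.supportDim R (R ⧸ (Module.annihilator R N).radical) ≤ d :=
    (supportDim_le_of_annihilator_le
      (by rw [Ideal.annihilator_quotient]; exact Ideal.le_radical)).trans hd
  obtain ⟨ι, hι, P, hP, h2⟩ := exists_smallDiff_sum p s hs (FrobMod p k N)
    (Ideal.radical_isRadical _) hk hI
  have hPlim : ∀ i, ∃ L : ℝ, Tendsto
      (fun e => ((lenMod (frobIdeal R p s e) (R ⧸ P i)).toNat : ℝ) / (p : ℝ) ^ (e * d))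
      atTop (𝓝 L) := fun i => by
    have := (hP i).1.1
    refine exists_tendsto_prime p s hs hfin hres (P i)
      ((supportDim_le_of_annihilator_le ?_).trans hI)
    rw [Ideal.annihilator_quotient, Ideal.annihilator_quotient]
    exact (hP i).1.2
  choose L hL using hPlim
  have hfinP : ∀ i e, lenMod (frobIdeal R p s e) (R ⧸ P i) ≠ ⊤ :=
    fun i e => lenMod_frobIdeal_ne_top p s _ e
  have h3 := (h1.trans h2).tendsto_sub hp.one_lt (fun e => lenMod_frobIdeal_ne_top p s N (e + k))
    (fun e => by simp [ENat.sum_eq_top, hfinP])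
  have h4 : Tendsto (fun e => ((∑ i, lenMod (frobIdeal R p s e) (R ⧸ P i)).toNat : ℝ) /
      (p : ℝ) ^ (e * d)) atTop (𝓝 (∑ i, L i)) := by
    have : ∀ e, ((∑ i, lenMod (frobIdeal R p s e) (R ⧸ P i)).toNat : ℝ) / (p : ℝ) ^ (e * d) =
        ∑ i, ((lenMod (frobIdeal R p s e) (R ⧸ P i)).toNat : ℝ) / (p : ℝ) ^ (e * d) := by
      intro e
      rw [ENat.toNat_sum fun i _ => hfinP i e, Nat.cast_sum, Finset.sum_div]
    simp_rw [this]
    exact tendsto_finsetSum _ fun i _ => hL i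
  have h5 := (h3.add h4).div_const ((p : ℝ) ^ (k * d))
  -- Passing to the `k`-th pushforward shifts the index by `k`, which accounts for the division by
  -- `p ^ (k * d)`.
  refine ⟨_, (tendsto_add_atTop_iff_nat k).1 (h5.congr fun e => ?_)⟩
  rw [sub_add_cancel, div_div, ← pow_add, add_mul]

end Limit

theorem RingHom.Finite.of_forall_eq_sum {A B ι : Type*} [CommRing A] [CommRing B] [Fintype ι]
    (f : A →+* B) (v : ι → B) (h : ∀ b, ∃ g : ι → A, b = ∑ i, f (g i) * v i) : f.Finite := by
  classical
  let _ := f.toAlgebra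
  refine ⟨⟨Finset.univ.image v, eq_top_iff.2 fun b _ => ?_⟩⟩
  obtain ⟨g, hg⟩ := h b
  rw [hg]
  refine Submodule.sum_mem _ fun i _ => Submodule.smul_mem _ (g i) (Submodule.subset_span ?_)
  exact Finset.mem_coe.2 (Finset.mem_image_of_mem _ (Finset.mem_univ i))

/-! ### Power series rings over a perfect field -/

namespace MvPowerSeries

section Ideal

variable {σ K : Type*} [Field K]

/-- Induction on `S`: the terms divisible by `X a` form a multiple of `X a`, and what remains does
not involve `X a`. -/
theorem mem_span_X_of_coeff (S : Finset σ) (f : MvPowerSeries σ K)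
    (hf : ∀ α : σ →₀ ℕ, (∀ i ∈ S, α i = 0) → coeff α f = 0) :
    f ∈ Ideal.span (Set.range (X : σ → MvPowerSeries σ K)) := by
  classical
  induction S using Finset.induction_on generalizing f with
  | empty =>
    have : f = 0 := by
      ext α
      exact hf α (by simp)
    rw [this]
    exact Ideal.zero_mem _
  | insert a S ha ih =>
    let g : MvPowerSeries σ K := fun α => if α a = 0 then coeff α f else 0
    have hg : ∀ α, coeff α g = if α a = 0 then coeff α f else 0 := fun α => rfl
    have h1 : g ∈ Ideal.span (Set.range (X : σ → MvPowerSeries σ K)) := by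
      refine ih g fun α hα => ?_
      rw [hg]
      split_ifs with h
      · exact hf α (by simpa [h] using hα)
      · rfl
    have h2 : X a ∣ f - g := by
      rw [X_dvd_iff]
      intro α hα
      rw [map_sub, hg, if_pos hα, sub_self]
    obtain ⟨c, hc⟩ := h2
    have h3 : f = X a * c + g := by rw [← hc]; ring
    rw [h3]
    exact Ideal.add_mem _ (Ideal.mul_mem_right _ _ (Ideal.subset_span ⟨a, rfl⟩)) h1

theorem maximalIdeal_eq_span_X [Finite σ] :
    maximalIdeal (MvPowerSeries σ K) = Ideal.span (Set.range X) := by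
  cases nonempty_fintype σ
  apply le_antisymm
  · intro f hf
    rw [mem_maximalIdeal, mem_nonunits_iff, isUnit_iff_constantCoeff, isUnit_iff_ne_zero,
      not_not] at hf
    refine mem_span_X_of_coeff Finset.univ f fun α hα => ?_
    have : α = 0 := by
      ext i
      exact hα i (Finset.mem_univ i)
    rw [this]
    exact hf
  · rw [Ideal.span_le]
    rintro _ ⟨i, rfl⟩
    rw [SetLike.mem_coe, mem_maximalIdeal, mem_nonunits_iff, isUnit_iff_constantCoeff]
    simp

instance [Finite σ] : IsAdicComplete (maximalIdeal (MvPowerSeries σ K)) (MvPowerSeries σ K) := by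
  rw [maximalIdeal_eq_span_X]
  infer_instance

end Ideal

section Frobenius

variable {σ K : Type*} [Field K] (p : ℕ) [Fact p.Prime] [CharP K p]

instance charP : CharP (MvPowerSeries σ K) p :=
  charP_of_injective_algebraMap (C_injective (σ := σ) (R := K)) p

variable [PerfectRing K p]

theorem exists_sub_pow_mem_maximalIdeal (f : MvPowerSeries σ K) :
    ∃ g : MvPowerSeries σ K, f - g ^ p ∈ maximalIdeal (MvPowerSeries σ K) := by
  obtain ⟨a, ha⟩ := surjective_frobenius K p (constantCoeff f)
  refine ⟨C a, ?_⟩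
  rw [mem_maximalIdeal, mem_nonunits_iff, isUnit_iff_constantCoeff]
  rw [frobenius_def] at ha
  simp [ha]

/-- Divide each exponent by `p` with remainder, `γ = p • β + α`, and take `p`-th roots of the
coefficients, which exist as `K` is perfect. The monomials with exponents below `p` generate over
the `p`-th powers. -/
theorem eq_sum_pow_mul_monomial [Fintype σ] [DecidableEq σ] (f : MvPowerSeries σ K) :
    ∃ g : (σ → Fin p) → MvPowerSeries σ K, f = ∑ α, g α ^ p *
      monomial (Finsupp.equivFunOnFinite.symm fun i => (α i : ℕ)) 1 := by
  have hp := (Fact.out (p := p.Prime))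
  let e : (σ → Fin p) → (σ →₀ ℕ) := fun α => Finsupp.equivFunOnFinite.symm fun i => (α i : ℕ)
  have he : ∀ α i, e α i = α i := fun α i => rfl
  let g : (σ → Fin p) → MvPowerSeries σ K := fun α β =>
    (frobeniusEquiv K p).symm (coeff (p • β + e α) f)
  have hg : ∀ α β, coeff β (g α) = (frobeniusEquiv K p).symm (coeff (p • β + e α) f) :=
    fun α β => rfl
  refine ⟨g, ?_⟩
  ext γ
  rw [map_sum]
  let α₀ : σ → Fin p := fun i => ⟨γ i % p, Nat.mod_lt _ hp.pos⟩
  let β : σ →₀ ℕ := Finsupp.equivFunOnFinite.symm fun i => γ i / p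
  have hγ : γ = p • β + e α₀ := by
    ext i
    rw [Finsupp.add_apply, Finsupp.smul_apply, he]
    exact (Nat.div_add_mod (γ i) p).symm
  rw [Finset.sum_eq_single α₀]
  · change coeff γ f = coeff γ (g α₀ ^ p * monomial (e α₀) 1)
    conv_rhs => rw [hγ]
    rw [coeff_add_mul_monomial, ← map_frobenius_expand p hp.ne_zero, coeff_map,
      coeff_expand_smul, hg, ← hγ, mul_one]
    exact (frobenius_apply_frobeniusEquiv_symm K p _).symm
  · intro α _ hα
    change coeff γ (g α ^ p * monomial (e α) 1) = 0
    rw [coeff_mul_monomial]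
    split_ifs with hle
    · rw [mul_one, ← map_frobenius_expand p hp.ne_zero, coeff_map]
      obtain ⟨i, hi⟩ : ∃ i, α i ≠ α₀ i := by
        by_contra! h
        exact hα (funext h)
      rw [coeff_expand_of_not_dvd p hp.ne_zero (i := i), map_zero]
      intro hdvd
      apply hi
      rw [Finsupp.tsub_apply, he] at hdvd
      ext
      have h2 : (α i : ℕ) ≤ γ i := hle i
      have h3 := (Nat.modEq_iff_dvd' h2).2 hdvd
      rw [Nat.ModEq, Nat.mod_eq_of_lt (α i).2] at h3
      exact h3
    · rfl
  · intro h
    exact absurd (Finset.mem_univ _) h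

theorem frobenius_finite [Finite σ] : (frobenius (MvPowerSeries σ K) p).Finite := by
  classical
  cases nonempty_fintype σ
  refine RingHom.Finite.of_forall_eq_sum _ (fun α : σ → Fin p =>
    (monomial (Finsupp.equivFunOnFinite.symm fun i => (α i : ℕ)) 1 : MvPowerSeries σ K))
    fun f => ?_
  obtain ⟨g, hg⟩ := eq_sum_pow_mul_monomial p f
  exact ⟨g, hg⟩

end Frobenius

section Flat

variable (σ k K : Type*) [Field k] [Field K] [Algebra k K]

/-- The inclusion of `k[X]` in `K⟦X⟧`. -/
def ofMvPolynomial : MvPolynomial σ k →+* MvPowerSeries σ K :=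
  (MvPolynomial.coeToMvPowerSeries.ringHom (R := K)).comp (MvPolynomial.map (algebraMap k K))

/-- `k[X] → K[X]` is a base change of a field extension, and `K[X] → K⟦X⟧` is an adic completion of
a Noetherian ring. -/
theorem ofMvPolynomial_flat [Finite σ] : (ofMvPolynomial σ k K).Flat := by
  refine RingHom.Flat.comp ?_ ?_
  · let _ : Algebra (MvPolynomial σ k) (MvPolynomial σ K) := MvPolynomial.algebraMvPolynomial
    have : Algebra.IsPushout k (MvPolynomial σ k) K (MvPolynomial σ K) :=
      Algebra.IsPushout.symm inferInstance
    exact Module.Flat.isBaseChange k (MvPolynomial σ k) K (MvPolynomial σ K) this.out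
  · have : Module.Flat (MvPolynomial σ K) (MvPowerSeries σ K) :=
      Module.Flat.of_linearEquiv (toAdicCompletionAlgEquiv σ K).toLinearEquiv
    exact this

end Flat

end MvPowerSeries

/-! ### Lifting fields of characteristic `p` along square-zero extensions -/

section Lift

variable {k A' A : Type*} [Field k] [CommRing A'] [CommRing A]

/-- Subrings of `k × A'` that are graphs of partial lifts of `σ` along `π`. -/
structure IsPartialLift (p : ℕ) (π : A' →+* A) (σ : k →+* A) (G : Subring (k × A')) : Prop where
  compat : ∀ x ∈ G, σ x.1 = π x.2
  eq_zero : ∀ x ∈ G, x.1 = 0 → x = 0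
  pow_mem : ∀ x : k × A', σ x.1 = π x.2 → x ^ p ∈ G

variable {p : ℕ} [hp : Fact p.Prime] {π : A' →+* A} {σ : k →+* A}

/-- If `z` lifts `σ x.1⁻¹`, the pair `(x.1⁻¹, z)` need not be in `G` but its `p`-th power is, and `x
^ (p - 1)` times it inverts `x`. -/
theorem IsPartialLift.isField (hπ : Function.Surjective π) {G : Subring (k × A')}
    (hG : IsPartialLift p π σ G) : IsField G where
  exists_pair_ne := ⟨0, 1, fun h => by
    have := congrArg (fun x : G => x.1.1) h
    simp at this⟩
  mul_comm := mul_comm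
  mul_inv_cancel := by
    rintro ⟨x, hx⟩ hx0
    have h1 : x.1 ≠ 0 := fun h => hx0 (Subtype.ext (hG.eq_zero x hx h))
    obtain ⟨z, hz⟩ := hπ (σ x.1⁻¹)
    refine ⟨⟨x ^ (p - 1) * (x.1⁻¹, z) ^ p,
      G.mul_mem (G.pow_mem hx _) (hG.pow_mem _ hz.symm)⟩, ?_⟩
    rw [← sub_eq_zero]
    refine Subtype.ext (hG.eq_zero _ (Subtype.property _) ?_)
    change x.1 * (x.1 ^ (p - 1) * x.1⁻¹ ^ p) - 1 = 0
    rw [← mul_assoc, mul_pow_sub_one hp.out.ne_zero, ← mul_pow, mul_inv_cancel₀ h1, one_pow,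
      sub_self]

variable [CharP k p] [CharP A' p]

/-- The `p`-th powers of compatible pairs already form a partial lift: two lifts of an element
differ by something of square zero, which the `p`-th power kills since `p ≥ 2`. -/
theorem exists_isPartialLift (hker : ∀ x y, π x = 0 → π y = 0 → x * y = 0) :
    ∃ G : Subring (k × A'), IsPartialLift p π σ G := by
  let E : Subring (k × A') := RingHom.eqLocus (σ.comp (RingHom.fst k A')) (π.comp (RingHom.snd k A'))
  refine ⟨E.map (frobenius (k × A') p), ?_, ?_, ?_⟩
  · rintro _ ⟨x, hx, rfl⟩
    have hx : σ x.1 = π x.2 := hx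
    simp [frobenius_def, hx]
  · rintro _ ⟨x, hx, rfl⟩ h0
    have hx : σ x.1 = π x.2 := hx
    rw [frobenius_def, Prod.pow_fst] at h0
    have h1 : x.1 = 0 := eq_zero_of_pow_eq_zero h0
    have h2 : π x.2 = 0 := by rw [← hx, h1, map_zero]
    have h3 : x.2 ^ p = 0 := by
      rw [← Nat.sub_add_cancel hp.out.two_le, pow_add, pow_two, hker _ _ h2 h2, mul_zero]
    ext
    · exact h0
    · simpa [frobenius_def] using h3
  · intro x hx
    exact ⟨x, hx, rfl⟩

theorem exists_maximal_isPartialLift (hker : ∀ x y, π x = 0 → π y = 0 → x * y = 0) :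
    ∃ G : Subring (k × A'), Maximal (IsPartialLift p π σ) G := by
  obtain ⟨G₀, hG₀⟩ := exists_isPartialLift (p := p) (σ := σ) hker
  obtain ⟨G, -, hG⟩ := zorn_le_nonempty₀ {G : Subring (k × A') | IsPartialLift p π σ G}
    (fun c hc hchain G hG => by
      have hmem : ∀ x, x ∈ sSup c ↔ ∃ H ∈ c, x ∈ H := fun x =>
        Subring.mem_sSup_of_directedOn ⟨G, hG⟩ hchain.directedOn
      refine ⟨sSup c, ⟨?_, ?_, ?_⟩, fun H hH => le_sSup hH⟩
      · intro x hx
        obtain ⟨H, hH, hxH⟩ := (hmem x).1 hx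
        exact (hc hH).compat x hxH
      · intro x hx
        obtain ⟨H, hH, hxH⟩ := (hmem x).1 hx
        exact (hc hH).eq_zero x hxH
      · intro x hx
        exact (hmem _).2 ⟨G, hG, (hc hG).pow_mem x hx⟩) G₀ hG₀
  exact ⟨G, hG⟩

omit [CharP A' p] in
-- Otherwise adjoin `(a, y)` for any lift `y` of `σ a`. Its `p`-th power `c` is in the field `G` but
-- has no `p`-th root there, so `X ^ p - c` is the minimal polynomial of `a`; every relation
-- satisfied by `a` then holds for the pair, and the larger ring is again a partial lift.
theorem exists_mem_of_maximal_isPartialLift (hπ : Function.Surjective π)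
    {G : Subring (k × A')} (hG : Maximal (IsPartialLift p π σ) G) (a : k) :
    ∃ y, (a, y) ∈ G := by
  by_contra! hcon
  let _ : Field G := (hG.prop.isField hπ).toField
  obtain ⟨y, hy⟩ := hπ (σ a)
  let c : G := ⟨(a, y) ^ p, hG.prop.pow_mem (a, y) hy.symm⟩
  let φ : Polynomial G →+* k × A' := Polynomial.eval₂RingHom G.subtype (a, y)
  let _ : Algebra G k := ((RingHom.fst k A').comp G.subtype).toAlgebra
  have hfst : ∀ f, (φ f).1 = Polynomial.aeval a f := fun f =>
    Polynomial.hom_eval₂ f G.subtype (RingHom.fst k A') (a, y)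
  have hirr : Irreducible (Polynomial.X ^ p - Polynomial.C c) := by
    refine X_pow_sub_C_irreducible_of_prime hp.out fun b hb => ?_
    have h1 : b.1.1 ^ p = a ^ p := congrArg (fun x : G => x.1.1) hb
    have h2 : b.1.1 = a := frobenius_inj k p h1
    exact hcon b.1.2 (h2 ▸ b.2)
  have hφ : φ (Polynomial.X ^ p - Polynomial.C c) = 0 := by
    simp [φ, c]
  have hle : IsPartialLift p π σ φ.range := by
    refine ⟨?_, ?_, ?_⟩
    · rintro _ ⟨f, rfl⟩
      have : (σ.comp (RingHom.fst k A')).comp φ = (π.comp (RingHom.snd k A')).comp φ := by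
        ext g
        · simpa [φ] using hG.prop.compat g.1 g.2
        · simpa [φ] using hy.symm
      exact RingHom.congr_fun this f
    · rintro _ ⟨f, rfl⟩ h0
      rw [hfst] at h0
      have h1 : minpoly G a = Polynomial.X ^ p - Polynomial.C c :=
        (minpoly.eq_of_irreducible_of_monic hirr (by rw [← hfst, hφ]; rfl)
          (Polynomial.monic_X_pow_sub_C _ hp.out.ne_zero)).symm
      obtain ⟨g, hg⟩ := minpoly.dvd G a h0
      rw [hg, h1, map_mul, hφ, zero_mul]
    · intro x hx
      exact ⟨Polynomial.C ⟨x ^ p, hG.prop.pow_mem x hx⟩, by simp [φ]⟩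
  have h2 : φ.range ≤ G := hG.le_of_ge hle fun x hx => ⟨Polynomial.C ⟨x, hx⟩, by simp [φ]⟩
  exact hcon y (h2 ⟨Polynomial.X, by simp [φ]⟩)

/-- Fields of characteristic `p` lift along square-zero extensions of rings of
characteristic `p`. -/
theorem RingHom.exists_lift_of_squareZero (p : ℕ) [Fact p.Prime] [CharP k p] [CharP A' p]
    (π : A' →+* A) (hπ : Function.Surjective π)
    (hker : ∀ x y, π x = 0 → π y = 0 → x * y = 0) (σ : k →+* A) :
    ∃ σ' : k →+* A', π.comp σ' = σ := by
  obtain ⟨G, hG⟩ := exists_maximal_isPartialLift (p := p) (σ := σ) hker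
  let q : G →+* k := (RingHom.fst k A').comp G.subtype
  have hq : Function.Bijective q := by
    refine ⟨(injective_iff_map_eq_zero q).2 fun x hx => Subtype.ext (hG.prop.eq_zero x.1 x.2 hx),
      fun a => ?_⟩
    obtain ⟨y, hy⟩ := exists_mem_of_maximal_isPartialLift hπ hG a
    exact ⟨⟨(a, y), hy⟩, rfl⟩
  let e : G ≃+* k := RingEquiv.ofBijective q hq
  refine ⟨((RingHom.snd k A').comp G.subtype).comp (e.symm : k →+* G), ?_⟩
  ext a
  obtain ⟨x, rfl⟩ := e.surjective a
  change π (e.symm (e x)).1.2 = σ (e x)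
  rw [e.symm_apply_apply]
  exact (hG.prop.compat x.1 x.2).symm

end Lift

theorem exists_dependent_seq {α : ℕ → Type*} (r : ∀ t, α t → α (t + 1) → Prop)
    (h : ∀ t a, ∃ b, r t a b) (a₀ : α 0) :
    ∃ f : ∀ t, α t, f 0 = a₀ ∧ ∀ t, r t (f t) (f (t + 1)) := by
  choose g hg using h
  exact ⟨fun t => Nat.rec a₀ g t, rfl, fun t => hg t _⟩

/-! ### Compatible lifts of the residue field to the truncations -/

section Coefficient

theorem charP_quotient_of_ne_top (R : Type*) [CommRing R] (p : ℕ) [Fact p.Prime] [CharP R p]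
    {I : Ideal R} (hI : I ≠ ⊤) : CharP (R ⧸ I) p := by
  have : Nontrivial (R ⧸ I) := Ideal.Quotient.nontrivial_iff.2 hI
  refine (CharP.charP_iff_prime_eq_zero Fact.out).2 ?_
  rw [← map_natCast (Ideal.Quotient.mk I), CharP.cast_eq_zero, map_zero]

theorem RingHom.exists_lift_quotient {R k : Type*} [CommRing R] [Field k] (p : ℕ) [Fact p.Prime]
    [CharP R p] [CharP k p] {I J : Ideal R} (hIJ : I ≤ J) (hI : I ≠ ⊤) (hJ : J * J ≤ I)
    (σ : k →+* R ⧸ J) : ∃ σ' : k →+* R ⧸ I, (Ideal.Quotient.factor hIJ).comp σ' = σ := by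
  have := charP_quotient_of_ne_top R p hI
  refine RingHom.exists_lift_of_squareZero p _ (Ideal.Quotient.factor_surjective hIJ) ?_ σ
  intro x y hx hy
  obtain ⟨x, rfl⟩ := Ideal.Quotient.mk_surjective x
  obtain ⟨y, rfl⟩ := Ideal.Quotient.mk_surjective y
  rw [Ideal.Quotient.factor_mk, Ideal.Quotient.eq_zero_iff_mem] at hx hy
  rw [← map_mul, Ideal.Quotient.eq_zero_iff_mem]
  exact hJ (Ideal.mul_mem_mul hx hy)

/-- The transition map between the quotients by consecutive powers of the maximal ideal. -/
def powFactor (R : Type*) [CommRing R] [IsLocalRing R] (t : ℕ) :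
    R ⧸ maximalIdeal R ^ (t + 1 + 1) →+* R ⧸ maximalIdeal R ^ (t + 1) :=
  Ideal.Quotient.factor (Ideal.pow_le_pow_right (Nat.le_succ (t + 1)))

theorem powFactor_mk (R : Type*) [CommRing R] [IsLocalRing R] (t : ℕ) (a : R) :
    powFactor R t (Ideal.Quotient.mk _ a) = Ideal.Quotient.mk _ a := rfl

theorem exists_powFactor_lift (R : Type*) [CommRing R] [IsLocalRing R] (p : ℕ)
    [Fact p.Prime] [CharP R p] (t : ℕ)
    (σ : ResidueField R →+* R ⧸ maximalIdeal R ^ (t + 1)) :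
    ∃ σ' : ResidueField R →+* R ⧸ maximalIdeal R ^ (t + 1 + 1), (powFactor R t).comp σ' = σ := by
  have hk : CharP (R ⧸ maximalIdeal R) p :=
    charP_quotient_of_ne_top R p (maximalIdeal.isMaximal R).ne_top
  have hk : CharP (ResidueField R) p := hk
  refine RingHom.exists_lift_quotient p _ ?_ ?_ σ
  · intro h
    have h1 := Ideal.pow_le_self (I := maximalIdeal R) (Nat.add_one_ne_zero (t + 1))
    rw [h] at h1
    exact (maximalIdeal.isMaximal R).ne_top (top_le_iff.1 h1)
  · rw [← pow_add]
    exact Ideal.pow_le_pow_right (by omega)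

/-- Compatible lifts of the residue field to the quotients by the powers of the maximal ideal. -/
theorem exists_residueField_lifts (R : Type*) [CommRing R] [IsLocalRing R] (p : ℕ)
    [Fact p.Prime] [CharP R p] :
    ∃ σ : ∀ t : ℕ, ResidueField R →+* R ⧸ maximalIdeal R ^ (t + 1),
      (∀ t, (powFactor R t).comp (σ (t + 1)) = σ t) ∧
      ∀ a : R, Ideal.Quotient.mk _ a = σ 0 (residue R a) := by
  have h0 : maximalIdeal R ≤ maximalIdeal R ^ (0 + 1) := by rw [zero_add, pow_one]
  obtain ⟨σ, hσ0, hσ⟩ := exists_dependent_seq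
    (α := fun t => ResidueField R →+* R ⧸ maximalIdeal R ^ (t + 1))
    (fun t σ σ' => (powFactor R t).comp σ' = σ) (exists_powFactor_lift R p)
    (Ideal.Quotient.factor h0)
  refine ⟨σ, hσ, fun a => ?_⟩
  rw [hσ0]
  exact (Ideal.Quotient.factor_mk h0 a).symm

end Coefficient

/-! ### Complete modules and decreasing sequences of submodules -/

section Precomplete

variable {A M : Type*} [CommRing A] [AddCommGroup M] [Module A M] {I : Ideal A}

theorem IsPrecomplete.of_finite [IsPrecomplete I A] [Module.Finite A M] : IsPrecomplete I M := by
  rw [← AdicCompletion.of_surjective_iff]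
  intro y
  obtain ⟨z, rfl⟩ := AdicCompletion.ofTensorProduct_surjective_of_finite I M y
  induction z using TensorProduct.induction_on with
  | zero => exact ⟨0, by simp⟩
  | tmul a m =>
    obtain ⟨a, rfl⟩ := AdicCompletion.of_surjective I A a
    refine ⟨a • m, ?_⟩
    rw [AdicCompletion.ofTensorProduct_tmul, map_smul]
    ext n
    rfl
  | add x y hx hy =>
    obtain ⟨x', hx⟩ := hx
    obtain ⟨y', hy⟩ := hy
    exact ⟨x' + y', by rw [map_add, map_add, hx, hy]⟩

/-- In a complete module, a compatible sequence of submodules is determined by its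
intersection. -/
theorem le_iInf_sup_of_isPrecomplete [IsPrecomplete I M] (D : ℕ → Submodule A M)
    (h1 : Antitone D) (h2 : ∀ t, I ^ (t + 1) • (⊤ : Submodule A M) ≤ D t)
    (h3 : ∀ t, D t ≤ D (t + 1) ⊔ I ^ (t + 1) • (⊤ : Submodule A M)) (t : ℕ) :
    D t ≤ (⨅ u, D u) ⊔ I ^ (t + 1) • (⊤ : Submodule A M) := by
  intro x hx
  -- Correct `x` successively into `D (t + u)`, by elements of ever higher powers. The limit lies in
  -- every `D u`, since `D u` contains `I ^ (u + 1) • ⊤`.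
  obtain ⟨f, hf0, hf⟩ := exists_dependent_seq (α := fun u => D (t + u))
    (fun u y z => (y : M) - z ∈ I ^ (t + u + 1) • (⊤ : Submodule A M))
    (fun u y => by
      obtain ⟨z, hz, w, hw, hzw⟩ := Submodule.mem_sup.1 (h3 _ y.2)
      refine ⟨⟨z, hz⟩, ?_⟩
      rw [← hzw]
      simpa using hw) ⟨x, hx⟩
  have hcauchy : ∀ m n, m ≤ n → (f m : M) - f n ∈ I ^ (t + m + 1) • (⊤ : Submodule A M) := by
    intro m n hmn
    induction n, hmn using Nat.le_induction with
    | base => simp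
    | succ n hmn ih =>
      have h4 := Submodule.pow_smul_top_le I M (show t + m + 1 ≤ t + n + 1 by omega) (hf n)
      simpa using Submodule.add_mem _ ih h4
  obtain ⟨L, hL⟩ := IsPrecomplete.prec ‹IsPrecomplete I M› (f := fun n => (f n : M))
    fun {m n} hmn => SModEq.sub_mem.2
      (Submodule.pow_smul_top_le I M (show m ≤ t + m + 1 by omega) (hcauchy m n hmn))
  have hL' : ∀ n, (f n : M) - L ∈ I ^ n • (⊤ : Submodule A M) := fun n => SModEq.sub_mem.1 (hL n)
  refine Submodule.mem_sup.2 ⟨L, (Submodule.mem_iInf _).2 fun u => ?_, x - L, ?_, by abel⟩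
  · have h4 : (f (u + 1) : M) ∈ D u := h1 (show u ≤ t + (u + 1) by omega) (f (u + 1)).2
    have h5 := h2 u (hL' (u + 1))
    simpa using Submodule.sub_mem _ h4 h5
  · have h4 := hcauchy 0 (t + 1) (Nat.zero_le _)
    rw [hf0] at h4
    simpa using Submodule.add_mem _ h4 (hL' (t + 1))

end Precomplete

/-! ### Quotients presented over another ring -/

section Semilinear

variable {A A' F X : Type*} [CommRing A] [CommRing A'] [AddCommGroup F] [Module A F]
  [AddCommGroup X] [Module A' X] {ψ : A →+* A'}

theorem exists_mem_smul_top_of_mem_map_smul_top (hψ : Function.Surjective ψ) (f : F →ₛₗ[ψ] X)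
    (hf : Function.Surjective f) (I : Ideal A) {y : X}
    (hy : y ∈ I.map ψ • (⊤ : Submodule A' X)) : ∃ x ∈ I • (⊤ : Submodule A F), f x = y := by
  induction hy using Submodule.smul_induction_on' with
  | smul r hr z _ =>
    obtain ⟨a, ha, rfl⟩ := (Ideal.mem_map_iff_of_surjective ψ hψ).1 hr
    obtain ⟨x, rfl⟩ := hf z
    exact ⟨a • x, Submodule.smul_mem_smul ha trivial, f.map_smulₛₗ a x⟩
  | add y _ z _ hy hz =>
    obtain ⟨y', hy', rfl⟩ := hy
    obtain ⟨z', hz', rfl⟩ := hz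
    exact ⟨y' + z', Submodule.add_mem _ hy' hz', map_add _ _ _⟩

theorem map_mem_map_smul_top (f : F →ₛₗ[ψ] X) (I : Ideal A) {x : F}
    (hx : x ∈ I • (⊤ : Submodule A F)) : f x ∈ I.map ψ • (⊤ : Submodule A' X) := by
  induction hx using Submodule.smul_induction_on' with
  | smul r hr z _ =>
    rw [f.map_smulₛₗ]
    exact Submodule.smul_mem_smul (Ideal.mem_map_of_mem ψ hr) trivial
  | add y _ z _ hy hz =>
    rw [map_add]
    exact Submodule.add_mem _ hy hz

theorem length_quotient_ker_sup_eq_lenMod (hψ : Function.Surjective ψ) (f : F →ₛₗ[ψ] X)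
    (hf : Function.Surjective f) (I : Ideal A) :
    Module.length A (F ⧸ (LinearMap.ker f ⊔ I • (⊤ : Submodule A F))) = lenMod (I.map ψ) X := by
  let Q := X ⧸ (I.map ψ • (⊤ : Submodule A' X))
  let _ : Algebra A A' := ψ.toAlgebra
  let _ : Module A Q := Module.compHom Q ψ
  have : IsScalarTower A A' Q := ⟨fun r x y => mul_smul (ψ r) x y⟩
  let g : F →ₗ[A] Q :=
    { toFun := fun x => Submodule.Quotient.mk (f x)
      map_add' := fun x y => by rw [map_add]; rfl
      map_smul' := fun a x => by rw [f.map_smulₛₗ]; rfl }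
  have hg : Function.Surjective g := by
    intro y
    obtain ⟨y, rfl⟩ := Submodule.mkQ_surjective _ y
    obtain ⟨x, rfl⟩ := hf y
    exact ⟨x, rfl⟩
  have hker : LinearMap.ker g = LinearMap.ker f ⊔ I • (⊤ : Submodule A F) := by
    apply le_antisymm
    · intro x hx
      have h1 : f x ∈ I.map ψ • (⊤ : Submodule A' X) := (Submodule.Quotient.mk_eq_zero _).1 hx
      obtain ⟨y, hy, hyx⟩ := exists_mem_smul_top_of_mem_map_smul_top hψ f hf I h1
      refine Submodule.mem_sup.2 ⟨x - y, ?_, y, hy, by abel⟩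
      rw [LinearMap.mem_ker, map_sub, hyx, sub_self]
    · refine sup_le (fun x hx => ?_) fun x hx => ?_
      · exact (Submodule.Quotient.mk_eq_zero _).2 (by
          rw [LinearMap.mem_ker.1 hx]; exact Submodule.zero_mem _)
      · exact (Submodule.Quotient.mk_eq_zero _).2 (map_mem_map_smul_top f I hx)
  rw [← hker, (LinearMap.quotKerEquivOfSurjective g hg).length_eq]
  exact Module.length_eq_of_surjective (R := A') (M := Q) hψ

end Semilinear

/-! ### Length under flat base change -/

section BaseChange

open TensorProduct

variable {B : Type*} (P : Type*) [CommRing B] [CommRing P] [Algebra B P]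
  {X F : Type*} [AddCommGroup X] [Module B X] [AddCommGroup F] [Module B F]

theorem baseChange_sup (E E' : Submodule B F) :
    (E ⊔ E').baseChange P = E.baseChange P ⊔ E'.baseChange P := by
  simp only [Submodule.baseChange_eq_span, Submodule.map_sup]
  refine le_antisymm (Submodule.span_le.2 ?_) (sup_le ?_ ?_)
  · intro x hx
    obtain ⟨y, hy, z, hz, rfl⟩ := Submodule.mem_sup.1 hx
    exact Submodule.add_mem _ (Submodule.mem_sup_left (Submodule.subset_span hy))
      (Submodule.mem_sup_right (Submodule.subset_span hz))
  · exact Submodule.span_mono (SetLike.coe_subset_coe.2 le_sup_left)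
  · exact Submodule.span_mono (SetLike.coe_subset_coe.2 le_sup_right)

theorem baseChange_smul_top (I : Ideal B) :
    (I • (⊤ : Submodule B F)).baseChange P =
      I.map (algebraMap B P) • (⊤ : Submodule P (P ⊗[B] F)) := by
  apply le_antisymm
  · rw [Submodule.baseChange_eq_span, Submodule.span_le]
    rintro _ ⟨x, hx, rfl⟩
    induction hx using Submodule.smul_induction_on' with
    | smul r hr z _ =>
      have : (TensorProduct.mk B P F 1) (r • z) = algebraMap B P r • ((1 : P) ⊗ₜ[B] z) := by
        simp
      rw [SetLike.mem_coe, this]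
      exact Submodule.smul_mem_smul (Ideal.mem_map_of_mem _ hr) trivial
    | add y _ z _ hy hz =>
      rw [map_add]
      exact Submodule.add_mem _ hy hz
  · rw [Ideal.map, Submodule.span_smul_eq, Submodule.set_smul_le_iff]
    rintro _ x ⟨r, hr, rfl⟩ -
    induction x using TensorProduct.induction_on with
    | zero => simp
    | tmul a m =>
      have : algebraMap B P r • a ⊗ₜ[B] m = a ⊗ₜ (r • m) := by simp
      rw [this]
      exact Submodule.tmul_mem_baseChange_of_mem _ (Submodule.smul_mem_smul hr trivial)
    | add x y hx hy =>
      rw [smul_add]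
      exact Submodule.add_mem _ hx hy

/-- Base change commutes with quotients. -/
def quotientBaseChangeEquiv (E : Submodule B F) :
    ((P ⊗[B] F) ⧸ E.baseChange P) ≃ₗ[P] P ⊗[B] (F ⧸ E) :=
  (Submodule.quotEquivOfEq _ _ (by
    ext x
    exact ((lTensor_exact P (LinearMap.exact_subtype_mkQ E) E.mkQ_surjective) x).symm)).trans
    (LinearMap.quotKerEquivOfSurjective (E.mkQ.baseChange P)
      (LinearMap.lTensor_surjective P E.mkQ_surjective))

variable [Module.Flat B P] {J : Ideal B} [hJ : J.IsMaximal]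

/-- The simple quotient is `B ⧸ m` with `J ^ c ≤ m`, so `m = J`, and flatness keeps the sequence
exact. -/
theorem CovBy.length_baseChange_of_pow_smul {c : ℕ} {p q : Submodule B X} (h : p ⋖ q)
    (hc : J ^ c • (⊤ : Submodule B X) = ⊥) :
    Module.length P (q.baseChange P) =
      Module.length P (p.baseChange P) + Module.length P (P ⧸ J.map (algebraMap B P)) := by
  have e : ∀ N : Submodule B X, (P ⊗[B] N) ≃ₗ[P] N.baseChange P := fun N =>
    LinearEquiv.ofBijective (N.toBaseChange P) ⟨fun x y hxy => by
      refine Module.Flat.lTensor_preserves_injective_linearMap (M := P) N.subtype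
        N.subtype_injective ?_
      exact congrArg Subtype.val hxy, N.toBaseChange_surjective P⟩
  have hep : Module.length P (P ⊗[B] p) = Module.length P (p.baseChange P) := (e p).length_eq
  have heq : Module.length P (P ⊗[B] q) = Module.length P (q.baseChange P) := (e q).length_eq
  rw [← hep, ← heq]
  let f : p →ₗ[B] q := Submodule.inclusion h.le
  have key : IsSimpleModule B (q ⧸ LinearMap.range f) := by
    rwa [Submodule.range_inclusion, ← covBy_iff_quot_is_simple h.le]
  obtain ⟨m, hm, ⟨ε⟩⟩ := isSimpleModule_iff_quot_maximal.mp key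
  let g := ε.toLinearMap.comp (LinearMap.range f).mkQ
  have hg : Function.Surjective g := ε.surjective.comp (Submodule.mkQ_surjective _)
  have hJm : J = m := by
    refine hJ.eq_of_le hm.ne_top ?_
    refine hm.isPrime.le_of_pow_le (n := c) fun x hx => ?_
    obtain ⟨y, hy⟩ := hg (Ideal.Quotient.mk m 1)
    have h0 : x • y = 0 := Subtype.ext (by
      have : x • (y : X) ∈ J ^ c • (⊤ : Submodule B X) := Submodule.smul_mem_smul hx trivial
      rw [hc] at this
      exact this)
    have h1 : g (x • y) = Ideal.Quotient.mk m x := by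
      rw [map_smul, hy]
      change Ideal.Quotient.mk m (x * 1) = _
      rw [mul_one]
    rw [h0, map_zero] at h1
    exact Ideal.Quotient.eq_zero_iff_mem.1 h1.symm
  subst hJm
  have hf : Function.Injective f := Submodule.inclusion_injective _
  have hfg : Function.Exact f g := LinearMap.exact_iff.mpr (by
    rw [LinearEquiv.ker_comp, Submodule.ker_mkQ])
  rw [Module.length_eq_add_of_exact (f.baseChange P) (g.baseChange P)
    (Module.Flat.lTensor_preserves_injective_linearMap (M := P) f hf)
    (LinearMap.lTensor_surjective P hg) (lTensor_exact P hfg hg),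
    (Algebra.TensorProduct.quotIdealMapEquivTensorQuot P J).toLinearEquiv.length_eq]

theorem length_baseChange_of_pow_smul {c : ℕ} (hfin : Module.length B X ≠ ⊤)
    (hc : J ^ c • (⊤ : Submodule B X) = ⊥) :
    Module.length P (P ⊗[B] X) =
      Module.length B X * Module.length P (P ⧸ J.map (algebraMap B P)) := by
  obtain ⟨s, hs_bot, hs_top⟩ :=
    isFiniteLength_iff_exists_compositionSeries.mp (Module.length_ne_top_iff.1 hfin)
  rw [← Module.length_compositionSeries s hs_bot hs_top]
  suffices ∀ k, Module.length P ((s k).baseChange P) =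
      k * Module.length P (P ⧸ J.map (algebraMap B P)) by
    rw [← Fin.val_last s.length, ← this, ← RelSeries.last, hs_top, Submodule.baseChange_top,
      Module.length_top]
  intro k
  induction k using Fin.induction with
  | zero => rw [← RelSeries.head, hs_bot, Submodule.baseChange_bot]; simp
  | succ i hi => simpa [hi, add_one_mul] using (s.step i).length_baseChange_of_pow_smul P hc

end BaseChange

/-! ### Transfer of a module through its truncations -/

section Transfer

open TensorProduct

universe u

variable {R N : Type*} [CommRing R] [AddCommGroup N] [Module R N]

/-- The projection `N → N / 𝔞 N`, semilinear over `R → R / 𝔞`. -/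
def quotientSemilinear (𝔞 : Ideal R) (N : Type*) [AddCommGroup N] [Module R N] :
    N →ₛₗ[Ideal.Quotient.mk 𝔞] N ⧸ (𝔞 • (⊤ : Submodule R N)) where
  toFun x := Submodule.Quotient.mk x
  map_add' _ _ := rfl
  map_smul' _ _ := rfl

theorem quotientSemilinear_surjective (𝔞 : Ideal R) :
    Function.Surjective (quotientSemilinear 𝔞 N) := Submodule.mkQ_surjective _

theorem lenMod_map_mk {𝔞 I : Ideal R} (h : 𝔞 ≤ I) :
    lenMod (I.map (Ideal.Quotient.mk 𝔞)) (N ⧸ (𝔞 • (⊤ : Submodule R N))) = lenMod I N := by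
  rw [← length_quotient_ker_sup_eq_lenMod Ideal.Quotient.mk_surjective
    (quotientSemilinear 𝔞 N) (quotientSemilinear_surjective 𝔞) I]
  have : LinearMap.ker (quotientSemilinear 𝔞 N) = 𝔞 • (⊤ : Submodule R N) := by
    ext x
    exact Submodule.Quotient.mk_eq_zero _
  rw [this, sup_eq_right.2 (Submodule.smul_mono_left h), lenMod]

variable {B : Type*} [CommRing B] {r : ℕ}

/-- The combination of a family of elements of `N`, with coefficients from a ring mapping to
`R / 𝔞`, in `N / 𝔞 N`. -/
def combination {𝔞 : Ideal R} (ψ : B →+* R ⧸ 𝔞) (n : Fin r → N) :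
    (Fin r → B) →ₛₗ[ψ] N ⧸ (𝔞 • (⊤ : Submodule R N)) where
  toFun f := ∑ j, ψ (f j) • quotientSemilinear 𝔞 N (n j)
  map_add' f g := by simp [add_smul, Finset.sum_add_distrib]
  map_smul' b f := by simp [Finset.smul_sum, mul_smul]

theorem combination_apply {𝔞 : Ideal R} (ψ : B →+* R ⧸ 𝔞) (n : Fin r → N) (f : Fin r → B) :
    combination ψ n f = ∑ j, ψ (f j) • quotientSemilinear 𝔞 N (n j) := rfl

theorem combination_surjective {𝔞 : Ideal R} {ψ : B →+* R ⧸ 𝔞} (hψ : Function.Surjective ψ)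
    {n : Fin r → N} (hn : Submodule.span R (Set.range n) = ⊤) :
    Function.Surjective (combination ψ n) := by
  intro y
  obtain ⟨x, rfl⟩ := quotientSemilinear_surjective 𝔞 y
  have hx : x ∈ Submodule.span R (Set.range n) := hn ▸ trivial
  obtain ⟨c, rfl⟩ := (Submodule.mem_span_range_iff_exists_fun R).1 hx
  choose f hf using fun j => hψ (Ideal.Quotient.mk 𝔞 (c j))
  refine ⟨f, ?_⟩
  rw [map_sum, combination_apply]
  exact Finset.sum_congr rfl fun j _ => by rw [hf, LinearMap.map_smulₛₗ]

variable [IsLocalRing R]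

theorem factor_combination (t : ℕ) {ψ : B →+* R ⧸ maximalIdeal R ^ (t + 1)}
    {ψ' : B →+* R ⧸ maximalIdeal R ^ (t + 1 + 1)} (h : (powFactor R t).comp ψ' = ψ)
    (n : Fin r → N) (f : Fin r → B) :
    Submodule.factor (Submodule.pow_smul_top_le (maximalIdeal R) N (Nat.le_succ (t + 1)))
      (combination ψ' n f) = combination ψ n f := by
  subst h
  rw [combination_apply, combination_apply, map_sum]
  refine Finset.sum_congr rfl fun j _ => ?_
  rw [RingHom.comp_apply]
  obtain ⟨a, ha⟩ := Ideal.Quotient.mk_surjective (ψ' (f j))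
  rw [← ha]
  rfl

/-- Transfer of lengths to a complete local ring `P` that is flat over a ring `B` which maps onto
all the truncations of `R`. -/
theorem exists_module_lenMod_eq {B P : Type u} [CommRing B] [CommRing P] [IsLocalRing P]
    [Algebra B P] [Module.Flat B P] [IsPrecomplete (maximalIdeal P) P]
    {J : Ideal B} [J.IsMaximal] (hJ : J.map (algebraMap B P) = maximalIdeal P)
    [IsNoetherianRing R] [Module.Finite R N]
    (ψ : ∀ t, B →+* R ⧸ maximalIdeal R ^ (t + 1))
    (hcomp : ∀ t, (powFactor R t).comp (ψ (t + 1)) = ψ t)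
    (hsurj : ∀ t, Function.Surjective (ψ t))
    (hJψ : ∀ t, J.map (ψ t) = (maximalIdeal R).map (Ideal.Quotient.mk _)) :
    ∃ (N' : Type u) (_ : AddCommGroup N') (_ : Module P N'), Module.Finite P N' ∧
      ∀ (t : ℕ) (I : Ideal B) (I' : Ideal R), maximalIdeal R ^ (t + 1) ≤ I' → J ^ (t + 1) ≤ I →
        I.map (ψ t) = I'.map (Ideal.Quotient.mk _) →
        lenMod (I.map (algebraMap B P)) N' = lenMod I' N := by
  obtain ⟨r, n, hn⟩ := Module.Finite.exists_fin (R := R) (M := N)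
  -- `E t` is the module of relations among the chosen generators of `N` modulo `𝔪^(t+1)`.
  let E : ℕ → Submodule B (Fin r → B) := fun t => LinearMap.ker (combination (ψ t) n)
  have hpow : ∀ t s, (J ^ s).map (ψ t) = (maximalIdeal R ^ s).map (Ideal.Quotient.mk _) := by
    intro t s
    rw [Ideal.map_pow, Ideal.map_pow, hJψ]
  have hE1 : ∀ t, E (t + 1) ≤ E t := by
    intro t f hf
    rw [LinearMap.mem_ker] at hf ⊢
    rw [← factor_combination t (hcomp t), hf, map_zero]
  have hE2 : ∀ t, J ^ (t + 1) • (⊤ : Submodule B (Fin r → B)) ≤ E t := by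
    intro t f hf
    have h1 := map_mem_map_smul_top (combination (ψ t) n) _ hf
    rw [hpow, Ideal.map_quotient_self, Submodule.bot_smul] at h1
    exact h1
  -- A relation modulo `𝔪^(t+1)` becomes one modulo `𝔪^(t+2)` after a correction with coefficients
  -- in `J ^ (t + 1)`.
  have hE3 : ∀ t, E t ≤ E (t + 1) ⊔ J ^ (t + 1) • (⊤ : Submodule B (Fin r → B)) := by
    intro t f hf
    obtain ⟨z, hz⟩ := quotientSemilinear_surjective (maximalIdeal R ^ (t + 1 + 1)) (combination (ψ (t + 1)) n f)
    have h1 : z ∈ maximalIdeal R ^ (t + 1) • (⊤ : Submodule R N) := by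
      rw [LinearMap.mem_ker, ← factor_combination t (hcomp t), ← hz] at hf
      exact (Submodule.Quotient.mk_eq_zero _).1 hf
    have h2 := map_mem_map_smul_top (quotientSemilinear (maximalIdeal R ^ (t + 1 + 1)) N) _ h1
    rw [hz, ← hpow (t + 1)] at h2
    obtain ⟨g, hg, hgf⟩ := exists_mem_smul_top_of_mem_map_smul_top (hsurj (t + 1)) _
      (combination_surjective (hsurj (t + 1)) hn) _ h2
    refine Submodule.mem_sup.2 ⟨f - g, ?_, g, hg, by abel⟩
    rw [LinearMap.mem_ker, map_sub, hgf, sub_self]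
  let M := P ⊗[B] (Fin r → B)
  let D : ℕ → Submodule P M := fun t => (E t).baseChange P
  have hmap : ∀ s, (J ^ s • (⊤ : Submodule B (Fin r → B))).baseChange P =
      maximalIdeal P ^ s • (⊤ : Submodule P M) := by
    intro s
    rw [baseChange_smul_top, Ideal.map_pow, hJ]
  have : IsPrecomplete (maximalIdeal P) M := IsPrecomplete.of_finite
  have hD := le_iInf_sup_of_isPrecomplete (I := maximalIdeal P) D
    (antitone_nat_of_succ_le fun t => Submodule.baseChange_mono P (hE1 t))
    (fun t => by rw [← hmap]; exact Submodule.baseChange_mono P (hE2 t))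
    (fun t => by
      rw [← hmap, ← baseChange_sup]
      exact Submodule.baseChange_mono P (hE3 t))
  refine ⟨M ⧸ ⨅ u, D u, inferInstance, inferInstance, inferInstance, ?_⟩
  intro t I I' hI' hI hII'
  have hlen : Module.length B ((Fin r → B) ⧸ (E t ⊔ I • (⊤ : Submodule B (Fin r → B)))) =
      lenMod I' N := by
    rw [length_quotient_ker_sup_eq_lenMod (hsurj t) _ (combination_surjective (hsurj t) hn), hII',
      lenMod_map_mk hI']
  -- By completeness the intersection recovers `D t` up to `𝔪_P^(t+1)`, which the extension of `I ⊇
  -- J^(t+1)` absorbs.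
  have hsup : (⨅ u, D u) ⊔ I.map (algebraMap B P) • (⊤ : Submodule P M) =
      (E t ⊔ I • (⊤ : Submodule B (Fin r → B))).baseChange P := by
    rw [baseChange_sup, baseChange_smul_top]
    refine le_antisymm (sup_le_sup_right (iInf_le _ t) _) (sup_le ?_ le_sup_right)
    refine (hD t).trans (sup_le_sup_left (Submodule.smul_mono_left ?_) _)
    rw [← hJ, ← Ideal.map_pow]
    exact Ideal.map_mono hI
  have h1 := length_quotient_ker_sup_eq_lenMod (ψ := RingHom.id P) Function.surjective_id
    (⨅ u, D u).mkQ (Submodule.mkQ_surjective _) (I.map (algebraMap B P))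
  rw [Ideal.map_id, Submodule.ker_mkQ, hsup, (quotientBaseChangeEquiv P _).length_eq,
    length_baseChange_of_pow_smul (J := J) (c := t + 1) P, hJ, hlen] at h1
  · rw [← h1]
    have : IsSimpleModule P (P ⧸ maximalIdeal P) :=
      isSimpleModule_iff_isCoatom.2 (maximalIdeal.isMaximal P).out
    rw [Module.length_eq_one, mul_one]
  · rw [hlen]
    exact ne_top_of_le_ne_top (lenMod_pow_ne_top N (t + 1)) (lenMod_anti hI')
  · rw [eq_bot_iff]
    intro x hx
    obtain ⟨y, hy, rfl⟩ := exists_mem_smul_top_of_mem_map_smul_top (ψ := RingHom.id B)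
      Function.surjective_id (E t ⊔ I • (⊤ : Submodule B (Fin r → B))).mkQ
      (Submodule.mkQ_surjective _) (J ^ (t + 1)) (by rwa [Ideal.map_id])
    exact (Submodule.Quotient.mk_eq_zero _).2
      (Submodule.mem_sup_right (Submodule.smul_mono_left hI hy))

end Transfer

/-! ### Bounding the dimension by lengths -/

section Dimension

variable {R : Type*} [CommRing R]

theorem smul_top_eq_of_lenMod_eq {N : Type*} [AddCommGroup N] [Module R N] {A B : Ideal R}
    (hAB : A ≤ B) (h : lenMod A N = lenMod B N) (hB : lenMod B N ≠ ⊤) :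
    B • (⊤ : Submodule R N) = A • (⊤ : Submodule R N) := by
  have hle : A • (⊤ : Submodule R N) ≤ B • ⊤ := Submodule.smul_mono_left hAB
  refine le_antisymm (fun x hx => ?_) hle
  have h1 : lenMod A N = Module.length R (LinearMap.ker (Submodule.factor hle)) + lenMod B N :=
    Module.length_eq_add_of_exact (Submodule.subtype _) _ (Submodule.subtype_injective _)
      (Submodule.factor_surjective _) (LinearMap.exact_subtype_ker_map _)
  have h2 : Module.length R (LinearMap.ker (Submodule.factor hle)) = 0 := by
    rw [h] at h1
    have h1' : 0 + lenMod B N = Module.length R (LinearMap.ker (Submodule.factor hle)) +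
        lenMod B N := by rw [← h1, zero_add]
    exact (ENat.add_left_injective_of_ne_top hB h1').symm
  have h3 := Module.length_eq_zero_iff.1 h2
  have h4 : (⟨Submodule.mkQ _ x, by simpa using hx⟩ : LinearMap.ker (Submodule.factor hle)) = 0 :=
    Subsingleton.elim _ _
  have h5 := congrArg Subtype.val h4
  simpa using h5

variable [IsLocalRing R]

theorem supportDim_nonpos_of_pow_smul {N : Type*} [AddCommGroup N] [Module R N] {c : ℕ}
    (h : maximalIdeal R ^ c • (⊤ : Submodule R N) = ⊥) : Module.supportDim R N ≤ 0 := by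
  have hsub : ∀ q ∈ Module.support R N, q = closedPoint R := by
    intro q hq
    refine PrimeSpectrum.ext ?_
    refine ((maximalIdeal.isMaximal R).eq_of_le q.2.ne_top ?_).symm
    refine q.2.le_of_pow_le (n := c) fun x hx => ?_
    refine Module.annihilator_le_of_mem_support hq (Module.mem_annihilator.2 fun y => ?_)
    have : x • y ∈ maximalIdeal R ^ c • (⊤ : Submodule R N) := Submodule.smul_mem_smul hx trivial
    rwa [h] at this
  have : Subsingleton (Module.support R N) :=
    ⟨fun a b => Subtype.ext ((hsub a a.2).trans (hsub b b.2).symm)⟩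
  exact Order.krullDim_nonpos_of_subsingleton

variable [IsNoetherianRing R]

open Pointwise in
theorem supportDim_le_card (S : Finset R) (hS : ∀ x ∈ S, x ∈ maximalIdeal R) (c : ℕ)
    (N : Type*) [AddCommGroup N] [Module R N] [Module.Finite R N]
    (h : maximalIdeal R ^ c • (⊤ : Submodule R N) ≤ Ideal.span (S : Set R) • ⊤) :
    Module.supportDim R N ≤ S.card := by
  classical
  induction S using Finset.induction_on generalizing N with
  | empty =>
    rw [Finset.card_empty]
    refine supportDim_nonpos_of_pow_smul (c := c) (le_bot_iff.1 ?_)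
    simpa using h
  | insert a S ha ih =>
    have h1 := Module.supportDim_le_supportDim_quotSMulTop_succ (M := N)
      (hS a (Finset.mem_insert_self _ _))
    refine h1.trans ?_
    rw [Finset.card_insert_of_notMem ha]
    push_cast
    refine add_le_add_left (ih (fun x hx => hS x (Finset.mem_insert_of_mem hx)) _ ?_) 1
    have hsurj : Function.Surjective (Submodule.mkQ (a • (⊤ : Submodule R N))) :=
      Submodule.mkQ_surjective _
    have hmap : ∀ I : Ideal R, I • (⊤ : Submodule R (QuotSMulTop a N)) =
        (I • (⊤ : Submodule R N)).map (Submodule.mkQ (a • (⊤ : Submodule R N))) := by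
      intro I
      rw [Submodule.map_smul'', Submodule.map_top, LinearMap.range_eq_top.2 hsurj]
    rw [hmap, hmap]
    refine (Submodule.map_mono h).trans ?_
    rw [Finset.coe_insert, Ideal.span_insert, Submodule.sup_smul, Submodule.map_sup]
    refine sup_le ?_ le_rfl
    rw [Submodule.map_le_iff_le_comap, Submodule.ideal_span_singleton_smul]
    intro x hx
    rw [Submodule.mem_comap, Submodule.mkQ_apply, (Submodule.Quotient.mk_eq_zero _).2 hx]
    exact Submodule.zero_mem _

/-- Equal lengths force `𝔪^c N ⊆ (S)N + 𝔪·𝔪^c N`, and Nakayama removes the last term. Thus the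
dimension bound is read off from lengths, which the transfer preserves. -/
theorem supportDim_le_card_of_lenMod_eq (S : Finset R) (hS : ∀ x ∈ S, x ∈ maximalIdeal R) (c : ℕ)
    (N : Type*) [AddCommGroup N] [Module R N] [Module.Finite R N]
    (h : lenMod (Ideal.span (S : Set R) ⊔ maximalIdeal R ^ (c + 1)) N =
      lenMod (Ideal.span (S : Set R) ⊔ maximalIdeal R ^ c) N) :
    Module.supportDim R N ≤ S.card := by
  refine supportDim_le_card S hS c N ?_
  have h1 := smul_top_eq_of_lenMod_eq
    (sup_le_sup_left (Ideal.pow_le_pow_right (Nat.le_succ c)) (Ideal.span (S : Set R))) h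
    (ne_top_of_le_ne_top (lenMod_pow_ne_top N c) (lenMod_anti le_sup_right))
  rw [Submodule.sup_smul, Submodule.sup_smul, pow_succ', mul_smul] at h1
  exact Submodule.le_of_le_smul_of_le_jacobson_bot (IsNoetherian.noetherian _)
    (maximalIdeal_le_jacobson _) (le_sup_right.trans h1.le)

end Dimension

/-! ### Ideals and surjectivity under ring maps -/

section Map

variable {A B : Type*} [CommRing A] [CommRing B]

theorem map_pow_add_bracketPower (p : ℕ) [Fact p.Prime] [CharP A p] [CharP B p] (φ : A →+* B)
    (J : Ideal A) (a e : ℕ) : (J ^ a + bracketPower J (p ^ e)).map φ =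
      J.map φ ^ a + bracketPower (J.map φ) (p ^ e) := by
  rw [bracketPower_eq_map, bracketPower_eq_map, Submodule.add_eq_sup, Submodule.add_eq_sup,
    Ideal.map_sup, Ideal.map_pow, Ideal.map_map, Ideal.map_map]
  congr 2
  ext x
  simp [iterateFrobenius_def]

/-- Successive approximation along powers of the extended ideal: generators of the `s`-th power come
from `J ^ s`, and their coefficients can be replaced by images modulo `J`. -/
theorem surjective_of_forall_exists_sub_mem (ψ : A →+* B) (J : Ideal A) {n : ℕ}
    (h : ∀ b, ∃ a, b - ψ a ∈ J.map ψ) (hn : J.map ψ ^ n = ⊥) : Function.Surjective ψ := by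
  have key : ∀ s b, ∃ a, b - ψ a ∈ J.map ψ ^ s := by
    intro s
    induction s with
    | zero => exact fun b => ⟨0, by simp⟩
    | succ s ih =>
      intro b
      obtain ⟨a, ha⟩ := ih b
      suffices ∀ z ∈ J.map ψ ^ s, ∃ a, z - ψ a ∈ J.map ψ ^ (s + 1) by
        obtain ⟨a', ha'⟩ := this _ ha
        exact ⟨a + a', by rwa [map_add, ← sub_sub]⟩
      intro z hz
      rw [← Ideal.map_pow] at hz
      induction hz using Submodule.span_induction with
      | mem x hx =>
        obtain ⟨j, -, rfl⟩ := hx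
        exact ⟨j, by simp⟩
      | zero => exact ⟨0, by simp⟩
      | add x y _ _ hx hy =>
        obtain ⟨u, hu⟩ := hx
        obtain ⟨v, hv⟩ := hy
        exact ⟨u + v, by simpa [add_sub_add_comm] using Ideal.add_mem _ hu hv⟩
      | smul r x hx hx' =>
        obtain ⟨v, hv⟩ := hx'
        obtain ⟨w, hw⟩ := h r
        refine ⟨w * v, ?_⟩
        have h1 : r • x - ψ (w * v) = (r - ψ w) * x + ψ w * (x - ψ v) := by
          rw [map_mul, smul_eq_mul]
          ring
        rw [h1]
        refine Ideal.add_mem _ ?_ (Ideal.mul_mem_left _ _ hv)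
        rw [pow_succ', ← Ideal.map_pow]
        exact Ideal.mul_mem_mul hw hx
  intro b
  obtain ⟨a, ha⟩ := key n b
  rw [hn, Ideal.mem_bot, sub_eq_zero] at ha
  exact ⟨a, ha.symm⟩

end Map

section Truncation

variable {R : Type*} [CommRing R] [IsLocalRing R]

/-- Each `σ t` is a section of the residue map: membership in the image of `𝔪` can be tested one
truncation lower, as `𝔪` contains the kernel. -/
theorem mk_sub_residueField_lift_mem
    (σ : ∀ t : ℕ, ResidueField R →+* R ⧸ maximalIdeal R ^ (t + 1))
    (h : ∀ t, (powFactor R t).comp (σ (t + 1)) = σ t)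
    (h0 : ∀ a : R, Ideal.Quotient.mk _ a = σ 0 (residue R a)) (t : ℕ) (a : R) :
    Ideal.Quotient.mk _ a - σ t (residue R a) ∈
      (maximalIdeal R).map (Ideal.Quotient.mk (maximalIdeal R ^ (t + 1))) := by
  induction t with
  | zero => rw [h0, sub_self]; exact Ideal.zero_mem _
  | succ t ih =>
    obtain ⟨w, hw⟩ := Ideal.Quotient.mk_surjective
      (Ideal.Quotient.mk (maximalIdeal R ^ (t + 1 + 1)) a - σ (t + 1) (residue R a))
    rw [← hw]
    refine Ideal.mem_map_of_mem _ ?_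
    have h1 : Ideal.Quotient.mk (maximalIdeal R ^ (t + 1)) w =
        Ideal.Quotient.mk _ a - σ t (residue R a) := by
      rw [← powFactor_mk, hw, map_sub, powFactor_mk, ← h t]
      rfl
    rw [← h1, ← Ideal.mem_comap,
      Ideal.comap_map_mk (Ideal.pow_le_self (Nat.add_one_ne_zero t))] at ih
    exact ih

end Truncation

section IdealOfVars

theorem isMaximal_idealOfVars (σ k : Type*) [Field k] :
    (MvPolynomial.idealOfVars σ k).IsMaximal := by
  have h : MvPolynomial.idealOfVars σ k = RingHom.ker (MvPolynomial.constantCoeff (R := k)) := by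
    apply le_antisymm
    · rw [Ideal.span_le]
      rintro _ ⟨i, rfl⟩
      simp [RingHom.mem_ker]
    · intro f hf
      have : ∀ f : MvPolynomial σ k,
          f - MvPolynomial.C (MvPolynomial.constantCoeff f) ∈ MvPolynomial.idealOfVars σ k := by
        intro f
        induction f using MvPolynomial.induction_on with
        | C a => simp
        | add f g hf hg => simpa [add_sub_add_comm] using Ideal.add_mem _ hf hg
        | mul_X f i _ =>
          have : (MvPolynomial.X i : MvPolynomial σ k) ∈ MvPolynomial.idealOfVars σ k :=
            Ideal.subset_span ⟨i, rfl⟩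
          simpa using Ideal.mul_mem_left _ f this
      simpa [RingHom.mem_ker.1 hf] using this f
  rw [h]
  exact RingHom.ker_isMaximal_of_surjective _ fun a => ⟨MvPolynomial.C a, by simp⟩

end IdealOfVars

theorem MvPowerSeries.ofMvPolynomial_X (σ k K : Type*) [Field k] [Field K]
    [Algebra k K] (i : σ) : ofMvPolynomial σ k K (MvPolynomial.X i) = X i := by
  simp [ofMvPolynomial]

/-! ### Reduction to power series rings and existence of the limits -/

section Reduction

universe u

theorem exists_module_lenMod_eq_of_flat {R N : Type*} [CommRing R] [AddCommGroup N] [Module R N]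
    [IsLocalRing R] {B P : Type u} [CommRing B] [CommRing P] [IsLocalRing P]
    (φ : B →+* P) (hφ : φ.Flat) [IsPrecomplete (maximalIdeal P) P]
    {J : Ideal B} [J.IsMaximal] (hJ : J.map φ = maximalIdeal P)
    [IsNoetherianRing R] [Module.Finite R N]
    (ψ : ∀ t, B →+* R ⧸ maximalIdeal R ^ (t + 1))
    (hcomp : ∀ t, (powFactor R t).comp (ψ (t + 1)) = ψ t)
    (hsurj : ∀ t, Function.Surjective (ψ t))
    (hJψ : ∀ t, J.map (ψ t) = (maximalIdeal R).map (Ideal.Quotient.mk _)) :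
    ∃ (N' : Type u) (_ : AddCommGroup N') (_ : Module P N'), Module.Finite P N' ∧
      ∀ (t : ℕ) (I : Ideal B) (I' : Ideal R), maximalIdeal R ^ (t + 1) ≤ I' → J ^ (t + 1) ≤ I →
        I.map (ψ t) = I'.map (Ideal.Quotient.mk _) →
        lenMod (I.map φ) N' = lenMod I' N := by
  let _ : Algebra B P := φ.toAlgebra
  have : Module.Flat B P := hφ
  exact exists_module_lenMod_eq (P := P) hJ ψ hcomp hsurj hJψ

variable {R : Type*} [CommRing R] [IsLocalRing R] [IsNoetherianRing R]

theorem exists_finset_ringKrullDim_eq : ∃ (S : Finset R) (c : ℕ),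
    (∀ x ∈ S, x ∈ maximalIdeal R) ∧ maximalIdeal R ^ c ≤ Ideal.span (S : Set R) ∧
      ringKrullDim R = S.card := by
  obtain ⟨S, hS, hcard⟩ :=
    Ideal.exists_finset_card_eq_height_of_isNoetherianRing (maximalIdeal R)
  have := quotient_artinian_of_mem_minimalPrimes_of_isLocalRing _ hS
  obtain ⟨c, hc⟩ := exists_maximalIdeal_pow_le_of_isArtinianRing_quotient
    (Ideal.span (S : Set R))
  refine ⟨S, c, fun x hx => hS.1.2 (Ideal.subset_span hx), hc, ?_⟩
  rw [← maximalIdeal_height_eq_ringKrullDim, ← hcard]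
  rfl

theorem krullDimNat_eq_of_ringKrullDim_eq {A : Type*} [CommRing A] {d : ℕ}
    (h : ringKrullDim A = d) : krullDimNat A = d := by
  rw [krullDimNat, h]
  rfl

variable (R) in
theorem ringKrullDim_eq_krullDimNat : ringKrullDim R = krullDimNat R := by
  obtain ⟨S, -, -, -, h⟩ := exists_finset_ringKrullDim_eq (R := R)
  rw [krullDimNat_eq_of_ringKrullDim_eq h, h]

variable (p : ℕ) [Fact p.Prime] [CharP R p] (s : ℝ) (N : Type*) [AddCommGroup N] [Module R N]
  [Module.Finite R N]

/-- Reduction to power series rings over an algebraically closed field. -/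
theorem exists_mvPowerSeries_module (R : Type u) [CommRing R] [IsLocalRing R] [IsNoetherianRing R]
    [CharP R p] [Module R N] [Module.Finite R N] :
    ∃ (K ι N' : Type u) (_ : Field K) (_ : CharP K p) (_ : PerfectRing K p) (_ : Finite ι)
      (_ : AddCommGroup N') (_ : Module (MvPowerSeries ι K) N'),
      Module.Finite (MvPowerSeries ι K) N' ∧
      Module.supportDim (MvPowerSeries ι K) N' ≤ krullDimNat R ∧
      ∀ e, lenMod (frobIdeal (MvPowerSeries ι K) p s e) N' = lenMod (frobIdeal R p s e) N := by
  classical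
  obtain ⟨S, c, hSm, hcS, hdim⟩ := exists_finset_ringKrullDim_eq (R := R)
  obtain ⟨G, hG⟩ := IsNoetherian.noetherian (maximalIdeal R)
  -- `G` generates `𝔪` and makes the truncations quotients of the polynomial ring; the parameters in
  -- `S` serve to bound the dimension of `N'`.
  let ι := ↥(S ∪ G)
  let x : ι → R := Subtype.val
  have hx : Ideal.span (Set.range x) = maximalIdeal R := by
    rw [Subtype.range_val]
    refine le_antisymm (Ideal.span_le.2 fun y hy => ?_) ?_
    · rcases Finset.mem_union.1 hy with h | h
      · exact hSm y h
      · exact hG ▸ Ideal.subset_span h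
    · rw [← hG]
      exact Ideal.span_mono (by simp)
  have hk : CharP (R ⧸ maximalIdeal R) p :=
    charP_quotient_of_ne_top R p (maximalIdeal.isMaximal R).ne_top
  let k := ResidueField R
  have hk : CharP k p := hk
  let K := AlgebraicClosure k
  have hK : CharP K p := charP_of_injective_algebraMap (algebraMap k K).injective p
  have hperf : PerfectRing K p := PerfectField.toPerfectRing p
  let B := MvPolynomial ι k
  let P := MvPowerSeries ι K
  let φ : B →+* P := MvPowerSeries.ofMvPolynomial ι k K
  have hφX : ∀ i, φ (MvPolynomial.X i) = MvPowerSeries.X i := fun i =>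
    MvPowerSeries.ofMvPolynomial_X ι k K i
  let J : Ideal B := MvPolynomial.idealOfVars ι k
  have hJmax : J.IsMaximal := isMaximal_idealOfVars ι k
  have hJ : J.map φ = maximalIdeal P := by
    rw [MvPowerSeries.maximalIdeal_eq_span_X, Ideal.map_span, ← Set.range_comp]
    congr 2
    exact funext hφX
  obtain ⟨σ, hσ, hσ0⟩ := exists_residueField_lifts R p
  let ψ : ∀ t, B →+* R ⧸ maximalIdeal R ^ (t + 1) := fun t =>
    MvPolynomial.eval₂Hom (σ t) fun i => Ideal.Quotient.mk _ (x i)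
  have hψC : ∀ t a, ψ t (MvPolynomial.C a) = σ t a := fun t a => MvPolynomial.eval₂Hom_C _ _ _
  have hψX : ∀ t i, ψ t (MvPolynomial.X i) = Ideal.Quotient.mk _ (x i) := fun t i =>
    MvPolynomial.eval₂Hom_X' _ _ _
  have hcomp : ∀ t, (powFactor R t).comp (ψ (t + 1)) = ψ t := by
    intro t
    refine MvPolynomial.ringHom_ext (fun a => ?_) fun i => ?_
    · rw [RingHom.comp_apply, hψC, hψC, ← hσ t, RingHom.comp_apply]
    · rw [RingHom.comp_apply, hψX, hψX, powFactor_mk]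
  have hspan : ∀ t (T : Set ι), (Ideal.span (MvPolynomial.X '' T)).map (ψ t) =
      (Ideal.span (x '' T)).map (Ideal.Quotient.mk _) := by
    intro t T
    rw [Ideal.map_span, Ideal.map_span, Set.image_image, Set.image_image]
    simp only [hψX]
  have hJψ : ∀ t, J.map (ψ t) = (maximalIdeal R).map (Ideal.Quotient.mk _) := by
    intro t
    have := hspan t Set.univ
    rwa [Set.image_univ, Set.image_univ, hx] at this
  have hsurj : ∀ t, Function.Surjective (ψ t) := by
    intro t
    refine surjective_of_forall_exists_sub_mem (ψ t) J (n := t + 1) (fun b => ?_) ?_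
    · obtain ⟨a, rfl⟩ := Ideal.Quotient.mk_surjective b
      refine ⟨MvPolynomial.C (residue R a), ?_⟩
      rw [hψC, hJψ]
      exact mk_sub_residueField_lift_mem σ hσ hσ0 t a
    · rw [hJψ, ← Ideal.map_pow, Ideal.map_quotient_self]
  obtain ⟨N', i1, i2, hfin, hlen⟩ := exists_module_lenMod_eq_of_flat (N := N) φ
    (MvPowerSeries.ofMvPolynomial_flat ι k K) hJ ψ hcomp hsurj hJψ
  refine ⟨K, ι, N', inferInstance, hK, hperf, inferInstance, i1, i2, hfin, ?_, fun e => ?_⟩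
  · let T : Set ι := {i | (i : R) ∈ S}
    have hT : x '' T = S := by
      ext y
      constructor
      · rintro ⟨i, hi, rfl⟩
        exact hi
      · intro hy
        exact ⟨⟨y, Finset.mem_union_left _ hy⟩, hy, rfl⟩
    let T' : Finset ι := Finset.univ.filter fun i => (i : R) ∈ S
    let S' : Finset P := T'.image MvPowerSeries.X
    have hS' : (Ideal.span (MvPolynomial.X '' T)).map φ = Ideal.span (S' : Set P) := by
      rw [Ideal.map_span, Set.image_image, Finset.coe_image]
      simp only [hφX]
      congr 2
      ext i
      simp [T, T']
    have hcard : S'.card ≤ S.card := by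
      refine Finset.card_image_le.trans ?_
      refine Finset.card_le_card_of_injOn Subtype.val (fun i hi => ?_)
        Subtype.val_injective.injOn
      exact (Finset.mem_filter.1 hi).2
    -- Modulo the parameters the truncated lengths stabilize, because `𝔪^c` already lies in the
    -- ideal they generate.
    have hconst : ∀ t, c ≤ t → lenMod (Ideal.span (S' : Set P) ⊔ maximalIdeal P ^ (t + 1)) N' =
        lenMod (Ideal.span (S : Set R)) N := by
      intro t ht
      have h1 : maximalIdeal R ^ (t + 1) ≤ Ideal.span (S : Set R) :=
        (Ideal.pow_le_pow_right (by omega)).trans hcS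
      rw [← hlen t (Ideal.span (MvPolynomial.X '' T) ⊔ J ^ (t + 1)) _ h1 le_sup_right,
        Ideal.map_sup, hS', Ideal.map_pow, hJ]
      rw [Ideal.map_sup, hspan, hT, Ideal.map_pow, hJψ, ← Ideal.map_pow, ← Ideal.map_sup,
        sup_eq_left.2 h1]
    rw [krullDimNat_eq_of_ringKrullDim_eq hdim]
    refine (supportDim_le_card_of_lenMod_eq S' (fun y hy => ?_) (c + 1) N' ?_).trans
      (by exact_mod_cast hcard)
    · obtain ⟨i, -, rfl⟩ := Finset.mem_image.1 hy
      rw [MvPowerSeries.maximalIdeal_eq_span_X]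
      exact Ideal.subset_span ⟨i, rfl⟩
    · rw [hconst c le_rfl, hconst (c + 1) (Nat.le_succ c)]
  · let a := ⌈s * (p : ℝ) ^ e⌉₊
    have hchar : CharP (R ⧸ maximalIdeal R ^ (a + 1)) p := by
      refine charP_quotient_of_ne_top R p fun h => ?_
      have h1 := Ideal.pow_le_self (I := maximalIdeal R) (Nat.add_one_ne_zero a)
      rw [h] at h1
      exact (maximalIdeal.isMaximal R).ne_top (top_le_iff.1 h1)
    have hB : CharP B p := charP_of_injective_algebraMap (MvPolynomial.C_injective ι k) p
    rw [← hlen a (J ^ a + bracketPower J (p ^ e)) (frobIdeal R p s e)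
      ((Ideal.pow_le_pow_right (Nat.le_succ a)).trans (pow_le_frobIdeal p s e))
      ((Ideal.pow_le_pow_right (Nat.le_succ a)).trans le_sup_left),
      map_pow_add_bracketPower, hJ]
    · rfl
    · rw [map_pow_add_bracketPower, hJψ, frobIdeal, map_pow_add_bracketPower]

theorem hasHLimit_maximalIdeal (hs : 0 < s) :
    HasHLimit p s (maximalIdeal R) (maximalIdeal R) N := by
  obtain ⟨K, ι, N', _, _, _, _, _, _, _, hdim, hlen⟩ := exists_mvPowerSeries_module p s N R
  obtain ⟨L, hL⟩ := exists_tendsto_of_frobenius_finite p s hs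
    (MvPowerSeries.frobenius_finite p) (MvPowerSeries.exists_sub_pow_mem_maximalIdeal p) N' hdim
  refine ⟨L, ?_⟩
  simp only [hlen] at hL
  exact hL

end Reduction

/-! ### Additivity on direct sums -/

section Prod

variable {R : Type*} [CommRing R] {N N' : Type*} [AddCommGroup N] [Module R N] [AddCommGroup N']
  [Module R N']

theorem lenMod_prod (I : Ideal R) : lenMod I (N × N') = lenMod I N + lenMod I N' := by
  unfold lenMod
  rw [← Module.length_prod]
  have key : I • (⊤ : Submodule R (N × N')) =
      (I • (⊤ : Submodule R N)).prod (I • (⊤ : Submodule R N')) := by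
    apply le_antisymm
    · rw [Submodule.smul_le]
      intro r hr n _
      exact ⟨Submodule.smul_mem_smul hr trivial, Submodule.smul_mem_smul hr trivial⟩
    · rintro ⟨x, y⟩ ⟨hx, hy⟩
      have h1 : LinearMap.inl R N N' x ∈ (I • (⊤ : Submodule R N)).map (LinearMap.inl R N N') :=
        ⟨x, hx, rfl⟩
      have h2 : LinearMap.inr R N N' y ∈ (I • (⊤ : Submodule R N')).map (LinearMap.inr R N N') :=
        ⟨y, hy, rfl⟩
      rw [Submodule.map_smul''] at h1 h2
      have h3 := Submodule.add_mem _ (smul_mono_right I (le_top (a := Submodule.map _ ⊤)) h1)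
        (smul_mono_right I (le_top (a := Submodule.map _ ⊤)) h2)
      simpa using h3
  let f : (N × N') →ₗ[R] (N ⧸ I • (⊤ : Submodule R N)) × (N' ⧸ I • (⊤ : Submodule R N')) :=
    (Submodule.mkQ _).prodMap (Submodule.mkQ _)
  have hf : Function.Surjective f :=
    Prod.map_surjective.2 ⟨Submodule.mkQ_surjective _, Submodule.mkQ_surjective _⟩
  have hker : LinearMap.ker f = I • (⊤ : Submodule R (N × N')) := by
    rw [LinearMap.ker_prodMap, Submodule.ker_mkQ, Submodule.ker_mkQ, key]
  rw [← hker]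
  exact (LinearMap.quotKerEquivOfSurjective f hf).length_eq

end Prod

/-! ### Lowering the exponent by one -/

section PredPow

variable {R : Type*} [CommRing R] [IsLocalRing R] [IsNoetherianRing R] (p : ℕ) [Fact p.Prime]
  (s : ℝ) (N : Type*) [AddCommGroup N] [Module R N] [Module.Finite R N]

theorem lenMod_pow_le_pow_sub_one (hs : 0 < s) {d : ℕ} (h : Module.supportDim R N ≤ d) :
    ∃ δ : ℕ → ℕ∞, IsSmall p d δ ∧ ∀ e, lenMod (maximalIdeal R ^ ⌈s * (p : ℝ) ^ e⌉₊) N ≤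
      lenMod (maximalIdeal R ^ (⌈s * (p : ℝ) ^ e⌉₊ - 1)) N + δ e := by
  obtain ⟨-, C, δ, hδ⟩ := lenMod_pow_growth d N h
  obtain ⟨D, hD⟩ := ENat.ne_top_iff_exists.1 (lenMod_pow_ne_top (R := R) N 1)
  let a : ℕ → ℕ := fun e => ⌈s * (p : ℝ) ^ e⌉₊
  have ha : ∀ e, 1 ≤ a e := one_le_ceil p s hs
  -- The growth bound starts at exponent 1, so the step from exponent 1 to 0 is paid for separately
  -- by `D`, the length of `N / 𝔪N`.
  refine ⟨fun e => ((if a e = 1 then D else δ (a e - 1) : ℕ) : ℕ∞), ?_, fun e => ?_⟩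
  · refine ⟨D * ⌈1 / s⌉₊ + 2 * ⌈1 / s⌉₊ * C * ⌈s⌉₊ ^ d, fun e => ?_⟩
    rw [← Nat.cast_mul, Nat.cast_le, add_mul]
    have h1 : p ^ e ≤ ⌈1 / s⌉₊ * a e := le_mul_ceil p s hs e
    have h2 : a e ≤ ⌈s⌉₊ * p ^ e := ceil_le_mul p s e
    split_ifs with h
    · rw [h, mul_one] at h1
      refine (Nat.mul_le_mul_left D h1).trans ((Nat.le_mul_of_pos_right _ ?_).trans
        (Nat.le_add_right _ _))
      exact pow_pos (Fact.out (p := p.Prime)).pos _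
    · refine le_trans ?_ (Nat.le_add_left _ _)
      obtain ⟨t, ht⟩ : ∃ t, a e = t + 1 := ⟨a e - 1, by have := ha e; omega⟩
      rw [ht] at h1 h2 h ⊢
      rw [Nat.add_sub_cancel]
      calc δ t * p ^ e ≤ δ t * (⌈1 / s⌉₊ * (2 * t)) := by
            refine Nat.mul_le_mul_left _ (h1.trans (Nat.mul_le_mul_left _ (by omega)))
        _ = 2 * ⌈1 / s⌉₊ * (t * δ t) := by ring
        _ ≤ 2 * ⌈1 / s⌉₊ * (C * t ^ d) := Nat.mul_le_mul_left _ (hδ t (by omega)).2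
        _ ≤ 2 * ⌈1 / s⌉₊ * (C * (⌈s⌉₊ * p ^ e) ^ d) := by gcongr; omega
        _ = _ := by rw [mul_pow, ← pow_mul]; ring
  · change lenMod (maximalIdeal R ^ a e) N ≤ lenMod (maximalIdeal R ^ (a e - 1)) N +
      ((if a e = 1 then D else δ (a e - 1) : ℕ) : ℕ∞)
    split_ifs with h
    · rw [h, ← hD]
      exact le_add_self
    · have h1 := (hδ (a e - 1) (by have := ha e; omega)).1
      rwa [Nat.sub_add_cancel (ha e)] at h1

end PredPow

/-! ### The idealization -/

namespace TrivSqZeroExt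

variable (R M : Type*) [CommRing R] [AddCommGroup M] [Module R M]

/-- The underlying module of `R ⋉ M`. -/
def linearEquivProd : TrivSqZeroExt R M ≃ₗ[R] R × M where
  toFun x := (x.fst, x.snd)
  invFun x := (x.1, x.2)
  map_add' _ _ := rfl
  map_smul' _ _ := rfl
  left_inv _ := rfl
  right_inv _ := rfl

theorem finite [Module.Finite R M] : Module.Finite R (TrivSqZeroExt R M) :=
  Module.Finite.equiv (linearEquivProd R M).symm

variable [Module Rᵐᵒᵖ M] [IsCentralScalar R M]

theorem isNoetherianRing [IsNoetherianRing R] [Module.Finite R M] :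
    IsNoetherianRing (TrivSqZeroExt R M) :=
  have := finite R M
  isNoetherian_of_tower R (isNoetherian_of_isNoetherianRing_of_finite R (TrivSqZeroExt R M))

theorem charP (p : ℕ) [CharP R p] : CharP (TrivSqZeroExt R M) p :=
  charP_of_injective_algebraMap (R := R) (A := TrivSqZeroExt R M)
    (by rw [algebraMap_eq_inl]; exact inl_injective) p

variable {R M}

theorem ideal_map_algebraMap (I : Ideal R) :
    I.map (algebraMap R (TrivSqZeroExt R M)) = idealizationIdeal M I := by
  apply le_antisymm
  · rw [Ideal.map_le_iff_le_comap]
    intro a ha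
    refine ⟨?_, ?_⟩
    · simpa [algebraMap_eq_inl] using ha
    · simp [algebraMap_eq_inl]
  · rintro x ⟨h1, h2⟩
    rw [← inl_fst_add_inr_snd_eq x]
    refine Ideal.add_mem _ ?_ ?_
    · rw [← algebraMap_eq_inl R M]
      exact Ideal.mem_map_of_mem _ h1
    · generalize x.snd = m at h2
      induction h2 using Submodule.smul_induction_on' with
      | smul r hr m _ =>
        have : (inr (r • m) : TrivSqZeroExt R M) = algebraMap R _ r * inr m := by
          simp [algebraMap_eq_inl, inl_mul_inr]
        rw [this]
        exact Ideal.mul_mem_right _ _ (Ideal.mem_map_of_mem _ hr)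
      | add m _ m' _ hm hm' =>
        rw [inr_add]
        exact Ideal.add_mem _ hm hm'

/-- The summand `M` squares to zero, so it lies in every prime and primes are determined by their
contractions to `R`. -/
theorem ringKrullDim_eq : ringKrullDim (TrivSqZeroExt R M) = ringKrullDim R := by
  apply le_antisymm
  · have hmem : ∀ (P : PrimeSpectrum (TrivSqZeroExt R M)) (x : TrivSqZeroExt R M),
        x ∈ P.asIdeal ↔ x.fst ∈ (PrimeSpectrum.comap (algebraMap R _) P).asIdeal := by
      intro P x
      have h1 : (inr x.snd : TrivSqZeroExt R M) ∈ P.asIdeal := by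
        refine P.2.mem_of_pow_mem 2 ?_
        rw [pow_two, inr_mul_inr]
        exact Ideal.zero_mem _
      rw [PrimeSpectrum.comap_asIdeal, Ideal.mem_comap, algebraMap_eq_inl]
      conv_lhs => rw [← inl_fst_add_inr_snd_eq x]
      exact Ideal.add_mem_iff_left _ h1
    refine Order.krullDim_le_of_strictMono (PrimeSpectrum.comap (algebraMap R _)) ?_
    refine Monotone.strictMono_of_injective (fun P Q h => Ideal.comap_mono h) fun P Q h => ?_
    refine PrimeSpectrum.ext (Ideal.ext fun x => ?_)
    rw [hmem, hmem, h]
  · exact ringKrullDim_le_of_surjective (fstHom R R M).toRingHom fst_surjective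

theorem krullDimNat_eq : krullDimNat (TrivSqZeroExt R M) = krullDimNat R := by
  rw [krullDimNat, ringKrullDim_eq, krullDimNat]

variable [IsLocalRing R]

theorem mem_maximalIdeal_iff {x : TrivSqZeroExt R M} :
    x ∈ maximalIdeal (TrivSqZeroExt R M) ↔ x.fst ∈ maximalIdeal R := by
  rw [mem_maximalIdeal, mem_maximalIdeal, mem_nonunits_iff, mem_nonunits_iff,
    isUnit_iff_isUnit_fst]

theorem lenMod_eq_length (I : Ideal (TrivSqZeroExt R M)) :
    lenMod I (TrivSqZeroExt R M) =
      Module.length R (TrivSqZeroExt R M ⧸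
        (I • (⊤ : Submodule (TrivSqZeroExt R M) (TrivSqZeroExt R M)))) := by
  refine (length_eq_of_residue_surjective (A := R) (fun b => ⟨b.fst, ?_⟩) _).symm
  rw [mem_maximalIdeal_iff, algebraMap_eq_inl]
  simp

theorem lenMod_map_algebraMap (I : Ideal R) :
    lenMod (I.map (algebraMap R (TrivSqZeroExt R M))) (TrivSqZeroExt R M) =
      lenMod I (TrivSqZeroExt R M) := by
  rw [lenMod_eq_length, lenMod]
  have h := Ideal.smul_restrictScalars (S := TrivSqZeroExt R M) I
    (⊤ : Submodule (TrivSqZeroExt R M) (TrivSqZeroExt R M))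
  rw [Submodule.restrictScalars_top] at h
  rw [← h]
  exact (Submodule.Quotient.restrictScalarsEquiv R _).symm.length_eq

theorem map_maximalIdeal_le :
    (maximalIdeal R).map (algebraMap R (TrivSqZeroExt R M)) ≤
      maximalIdeal (TrivSqZeroExt R M) := by
  rw [ideal_map_algebraMap]
  exact fun x hx => mem_maximalIdeal_iff.2 hx.1

/-- For `x = (r, m)` and `y = (r', m')` one has `x y = r y + r' (0, m)`, with both `y` and `(0, m)`
in the maximal ideal. -/
theorem maximalIdeal_mul_self_le :
    maximalIdeal (TrivSqZeroExt R M) * maximalIdeal (TrivSqZeroExt R M) ≤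
      (maximalIdeal R).map (algebraMap R (TrivSqZeroExt R M)) *
        maximalIdeal (TrivSqZeroExt R M) := by
  rw [Ideal.mul_le]
  intro x hx y hy
  have h : x * y = algebraMap R _ x.fst * y + algebraMap R _ y.fst * inr x.snd := by
    rw [algebraMap_eq_inl]
    ext <;> simp [mul_comm]
  rw [h]
  refine Ideal.add_mem _ ?_ ?_
  · exact Ideal.mul_mem_mul (Ideal.mem_map_of_mem _ (mem_maximalIdeal_iff.1 hx)) hy
  · refine Ideal.mul_mem_mul (Ideal.mem_map_of_mem _ (mem_maximalIdeal_iff.1 hy)) ?_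
    rw [mem_maximalIdeal_iff]
    simp

theorem maximalIdeal_pow_le (a : ℕ) :
    maximalIdeal (TrivSqZeroExt R M) ^ a ≤
      (maximalIdeal R).map (algebraMap R (TrivSqZeroExt R M)) ^ (a - 1) := by
  cases a with
  | zero => simp
  | succ a =>
    rw [Nat.add_sub_cancel]
    suffices maximalIdeal (TrivSqZeroExt R M) ^ (a + 1) ≤
        (maximalIdeal R).map (algebraMap R (TrivSqZeroExt R M)) ^ a *
          maximalIdeal (TrivSqZeroExt R M) from this.trans Ideal.mul_le_left
    induction a with
    | zero => simp
    | succ a ih =>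
      rw [pow_succ]
      refine (Ideal.mul_mono_left ih).trans ?_
      rw [mul_assoc, pow_succ, mul_assoc]
      exact Ideal.mul_mono_right maximalIdeal_mul_self_le

/-- The module part of `(r, m)^q` is `q r^(q-1) m`, which vanishes when `p` divides `q`; hence the
exclusion of `e = 0`. -/
theorem bracketPower_maximalIdeal (p : ℕ) [Fact p.Prime] [CharP R p] {e : ℕ} (he : e ≠ 0) :
    bracketPower (maximalIdeal (TrivSqZeroExt R M)) (p ^ e) =
      bracketPower ((maximalIdeal R).map (algebraMap R (TrivSqZeroExt R M))) (p ^ e) := by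
  apply le_antisymm
  · refine Ideal.span_le.2 ?_
    rintro _ ⟨x, hx, rfl⟩
    refine Ideal.subset_span ⟨algebraMap R _ x.fst,
      Ideal.mem_map_of_mem _ (mem_maximalIdeal_iff.1 hx), ?_⟩
    rw [algebraMap_eq_inl]
    have h0 : ((p ^ e : ℕ) : R) = 0 := by
      rw [Nat.cast_pow, CharP.cast_eq_zero, zero_pow he]
    ext
    · simp
    · simp only [snd_pow, snd_inl, smul_zero]
      rw [← Nat.cast_smul_eq_nsmul R, h0, zero_smul]
  · exact Ideal.span_mono (Set.image_mono map_maximalIdeal_le)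

theorem length_frobIdeal_map (p : ℕ) [Fact p.Prime] [CharP R p] (s : ℝ) (e : ℕ) :
    lenMod (idealizationIdeal M (maximalIdeal R) ^ ⌈s * (p : ℝ) ^ e⌉₊ +
        bracketPower (idealizationIdeal M (maximalIdeal R)) (p ^ e)) (TrivSqZeroExt R M) =
      lenMod (frobIdeal R p s e) (TrivSqZeroExt R M) := by
  have := charP R M p
  rw [← ideal_map_algebraMap, ← map_pow_add_bracketPower]
  exact lenMod_map_algebraMap _

variable [IsNoetherianRing R] [Module.Finite R M] (p : ℕ) [Fact p.Prime] [CharP R p] (s : ℝ)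

/-- With the bracket part fixed, the sandwich `(𝔪S)^a ⊆ 𝔫^a ⊆ (𝔪S)^(a-1)` leaves only the cost of
lowering the exponent by one. -/
theorem smallDiff_lenMod_maximalIdeal (hs : 0 < s) : SmallDiff p (krullDimNat R)
    (fun e => lenMod (maximalIdeal (TrivSqZeroExt R M) ^ ⌈s * (p : ℝ) ^ e⌉₊ +
      bracketPower ((maximalIdeal R).map (algebraMap R (TrivSqZeroExt R M))) (p ^ e))
      (TrivSqZeroExt R M))
    (fun e => lenMod (frobIdeal R p s e) (TrivSqZeroExt R M)) := by
  have := finite R M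
  have := charP R M p
  have hdim : Module.supportDim R (TrivSqZeroExt R M) ≤ krullDimNat R :=
    (Module.supportDim_le_ringKrullDim _ _).trans (ringKrullDim_eq_krullDimNat R).le
  obtain ⟨δ, hδ, h⟩ := lenMod_pow_le_pow_sub_one p s (TrivSqZeroExt R M) hs hdim
  refine ⟨δ, hδ, fun e => ?_, fun e => ?_⟩
  · refine le_add_right ?_
    beta_reduce
    rw [← lenMod_map_algebraMap, frobIdeal, map_pow_add_bracketPower]
    exact lenMod_anti (sup_le_sup_right (Ideal.pow_right_mono map_maximalIdeal_le _) _)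
  · refine (lenMod_sup_le (bracketPower (maximalIdeal R) (p ^ e))
      (Ideal.pow_le_pow_right (Nat.sub_le _ _)) (lenMod_pow_ne_top _ _) (h e)).trans ?_
    refine add_le_add_left ?_ _
    rw [← lenMod_map_algebraMap, ← Submodule.add_eq_sup, map_pow_add_bracketPower]
    exact lenMod_anti (sup_le_sup_right (maximalIdeal_pow_le _) _)

variable {p s}

theorem tendsto_hSeq_idealizationIdeal {L L' : ℝ}
    (hL : Tendsto (hSeq p s (maximalIdeal R) (maximalIdeal R) R) atTop (𝓝 L))
    (hL' : Tendsto (hSeq p s (maximalIdeal R) (maximalIdeal R) M) atTop (𝓝 L')) :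
    Tendsto (hSeq p s (idealizationIdeal M (maximalIdeal R)) (idealizationIdeal M (maximalIdeal R))
      (TrivSqZeroExt R M)) atTop (𝓝 (L + L')) := by
  refine (hL.add hL').congr fun e => ?_
  change ((lenMod (frobIdeal R p s e) R).toNat : ℝ) / (p : ℝ) ^ (e * krullDimNat R) +
    ((lenMod (frobIdeal R p s e) M).toNat : ℝ) / (p : ℝ) ^ (e * krullDimNat R) =
    ((lenMod (idealizationIdeal M (maximalIdeal R) ^ ⌈s * (p : ℝ) ^ e⌉₊ +
        bracketPower (idealizationIdeal M (maximalIdeal R)) (p ^ e))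
      (TrivSqZeroExt R M)).toNat : ℝ) / (p : ℝ) ^ (e * krullDimNat (TrivSqZeroExt R M))
  rw [length_frobIdeal_map, krullDimNat_eq, lenMod_congr _ (linearEquivProd R M), lenMod_prod,
    ENat.toNat_add (lenMod_frobIdeal_ne_top p s R e) (lenMod_frobIdeal_ne_top p s M e),
    Nat.cast_add, add_div]

theorem tendsto_hSeq_maximalIdeal (hs : 0 < s) {L L' : ℝ}
    (hL : Tendsto (hSeq p s (maximalIdeal R) (maximalIdeal R) R) atTop (𝓝 L))
    (hL' : Tendsto (hSeq p s (maximalIdeal R) (maximalIdeal R) M) atTop (𝓝 L')) :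
    Tendsto (hSeq p s (maximalIdeal (TrivSqZeroExt R M)) (maximalIdeal (TrivSqZeroExt R M))
      (TrivSqZeroExt R M)) atTop (𝓝 (L + L')) := by
  have := finite R M
  have := isNoetherianRing R M
  have h1 := (smallDiff_lenMod_maximalIdeal (R := R) (M := M) p s hs).tendsto_sub
    (Fact.out (p := p.Prime)).one_lt
    (fun e => ne_top_of_le_ne_top (lenMod_pow_ne_top _ _) (lenMod_anti le_sup_left))
    (fun e => lenMod_frobIdeal_ne_top p s _ e)
  have h2 := h1.add (tendsto_hSeq_idealizationIdeal hL hL')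
  rw [zero_add] at h2
  refine h2.congr' ?_
  filter_upwards [eventually_ne_atTop 0] with e he
  have h3 : hSeq p s (idealizationIdeal M (maximalIdeal R)) (idealizationIdeal M (maximalIdeal R))
      (TrivSqZeroExt R M) e = ((lenMod (frobIdeal R p s e) (TrivSqZeroExt R M)).toNat : ℝ) /
        (p : ℝ) ^ (e * krullDimNat R) := by
    rw [← length_frobIdeal_map, ← krullDimNat_eq (M := M)]
    rfl
  rw [h3, sub_add_cancel, ← bracketPower_maximalIdeal p he, ← krullDimNat_eq (M := M)]
  rfl

end TrivSqZeroExt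

theorem tendsto_hSeq_zero {R M : Type*} [CommRing R] [IsLocalRing R] [IsNoetherianRing R]
    {p : ℕ} [Fact p.Prime] [AddCommGroup M] [Module R M] [Module.Finite R M]
    {s : ℝ} (hs : 0 < s) (h : Module.supportDim R M < ringKrullDim R) :
    Tendsto (hSeq p s (maximalIdeal R) (maximalIdeal R) M) atTop (𝓝 0) := by
  rw [ringKrullDim_eq_krullDimNat] at h
  have h1 : SmallDiff p (krullDimNat R) (fun e => lenMod (frobIdeal R p s e) M) fun _ => 0 :=
    ⟨_, isSmall_lenMod p s M hs h, fun e => le_add_self, fun e => zero_le⟩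
  have h2 := h1.tendsto_sub (Fact.out (p := p.Prime)).one_lt
    (fun e => lenMod_frobIdeal_ne_top p s M e) fun e => ENat.zero_ne_top
  simp only [ENat.toNat_zero, Nat.cast_zero, zero_div, sub_zero] at h2
  exact h2

end

theorem corollary4p4 {R M : Type*} [CommRing R] [IsLocalRing R] [IsNoetherianRing R]
    (p : ℕ) [Fact p.Prime] [CharP R p]
    [AddCommGroup M] [Module R M] [Module Rᵐᵒᵖ M] [IsCentralScalar R M] [Module.Finite R M]
    (s : ℝ) (hs : 0 < s) :
    -- all the limits involved exist
    (HasHLimit p s (maximalIdeal R) (maximalIdeal R) R ∧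
      HasHLimit p s (maximalIdeal R) (maximalIdeal R) M ∧
      HasHLimit p s (maximalIdeal (TrivSqZeroExt R M)) (maximalIdeal (TrivSqZeroExt R M))
        (TrivSqZeroExt R M) ∧
      HasHLimit p s (idealizationIdeal M (maximalIdeal R)) (idealizationIdeal M (maximalIdeal R))
        (TrivSqZeroExt R M)) ∧
    sMultRing (TrivSqZeroExt R M) p s ≤ sMultIdeal p s (idealizationIdeal M (maximalIdeal R)) ∧
    sMultIdeal p s (idealizationIdeal M (maximalIdeal R)) =
      sMultRing R p s + sMultModule R p s M ∧
    (Module.supportDim R M < ringKrullDim R →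
      sMultRing (TrivSqZeroExt R M) p s ≤ sMultRing R p s) := by
  obtain ⟨L, hL⟩ := hasHLimit_maximalIdeal (R := R) p s R hs
  obtain ⟨L', hL'⟩ := hasHLimit_maximalIdeal (R := R) p s M hs
  have hT := TrivSqZeroExt.tendsto_hSeq_maximalIdeal hs hL hL'
  have hI := TrivSqZeroExt.tendsto_hSeq_idealizationIdeal hL hL'
  have eR : sMultRing R p s = L / hNormal s (krullDimNat R) :=
    congrArg (· / hNormal s (krullDimNat R)) hL.limUnder_eq
  have eM : sMultModule R p s M = L' / hNormal s (krullDimNat R) :=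
    congrArg (· / hNormal s (krullDimNat R)) hL'.limUnder_eq
  have eT : sMultRing (TrivSqZeroExt R M) p s = (L + L') / hNormal s (krullDimNat R) := by
    rw [← TrivSqZeroExt.krullDimNat_eq (M := M)]
    exact congrArg (· / hNormal s _) hT.limUnder_eq
  have eI : sMultIdeal p s (idealizationIdeal M (maximalIdeal R)) =
      (L + L') / hNormal s (krullDimNat R) := by
    rw [← TrivSqZeroExt.krullDimNat_eq (M := M)]
    exact congrArg (· / hNormal s _) hI.limUnder_eq
  refine ⟨⟨⟨L, hL⟩, ⟨L', hL'⟩, ⟨_, hT⟩, ⟨_, hI⟩⟩, ?_, ?_, fun hdim => ?_⟩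
  -- Both sides are the same quotient, so the inequality is an equality and the sign of the
  -- normalizing factor plays no role.
  · rw [eT, eI]
  · rw [eI, eR, eM, add_div]
  · rw [eT, eR, tendsto_nhds_unique hL' (tendsto_hSeq_zero hs hdim), add_zero]
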